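/- Let $\mathbb D$ and $\mathbb T$ be the open unit disk and the unit circle in $\mathbb C$, and let $\alpha>-1$. Write $\partial_z=\tfrac12(\partial_x-i\partial_y)$ and $\partial_{\bar z}=\tfrac12(\partial_x+i\partial_y)$. Let $f^*:\mathbb T\to\mathbb C$ be continuous and let $f\in C^2(\mathbb D)$ be a complex-valued function that maps $\mathbb D$ into $\mathbb D$ and solves the Dirichlet problem $$\Delta_\alpha f:=\partial_z\bigl((1-|z|^2)^{-\alpha}\,\partial_{\bar z}f\bigr)=0\ \text{ in }\mathbb D,\qquad f=f^*\ \text{ on }\mathbb T,$$ where the boundary condition means that $f(re^{i\theta})\to f^*(e^{i\theta})$ in the sense of distributions on $\mathbb T$ as $r\to1^-$. Then for every $z\in\mathbb D$, with $r=|z|$, $$\left|f(z)-\frac{(1-r^2)^{\alpha+1}}{1+r^2}f(0)\right|\le M(r,\alpha),$$ where $$M(r,\alpha)=\frac{(1-r^2)^{\alpha+1}\,\bigl|(1-r)^{-\alpha}-1\bigr|}{1+r^2}+\frac{C_\alpha\, r}{\pi}\,(1+r^2)^{\frac{\alpha}{2}-1}\;{}_2F_1\!\left(\frac12,\frac12-\frac\alpha2;\frac32;\frac{4r^2}{(1+r^2)^2}\right),$$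 with $C_\alpha=2^{2+\alpha/2}$ if $\alpha\ge0$ and $C_\alpha=4$ if $-1<\alpha<0$, and ${}_2F_1(a,b;c;x)=\sum_{n\ge0}\frac{(a)_n(b)_n}{(c)_n\,n!}x^n$ is the Gauss hypergeometric function. Moreover, for every $\alpha>-1$, the limit $\lim_{r\to1^-}M(r,\alpha)$ exists and is finite; in particular $M(r,\alpha)$ stays bounded as $r\to1^-$. -/

import Mathlib

open Filter Topology
open scoped ContDiff

noncomputable section

namespace AlphaHarmonic

/-- The Wirtinger derivative `∂_z f = (1/2) (∂f/∂x - i ∂f/∂y)`. -/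
def dz (f : ℂ → ℂ) (z : ℂ) : ℂ :=
  (1 / 2) * (fderiv ℝ f z 1 - Complex.I * fderiv ℝ f z Complex.I)

/-- The Wirtinger derivative `∂f/∂z̄ = (1/2) (∂f/∂x + i ∂f/∂y)`. -/
def dzbar (f : ℂ → ℂ) (z : ℂ) : ℂ :=
  (1 / 2) * (fderiv ℝ f z 1 + Complex.I * fderiv ℝ f z Complex.I)

/-- The weighted Laplacian `Δ_α f = ∂_z ((1 - |z|²)^(-α) ∂f/∂z̄)`. -/
def weightedLaplacian (α : ℝ) (f : ℂ → ℂ) : ℂ → ℂ :=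
  dz fun w => (((1 - ‖w‖ ^ 2) ^ (-α) : ℝ) : ℂ) * dzbar f w

/-- `f` is of class `C²` on the open unit disk and `Δ_α f = 0` there.  (Only the values of `f` on
the open unit disk matter.) -/
def IsAlphaHarmonic (α : ℝ) (f : ℂ → ℂ) : Prop :=
  ContDiffOn ℝ 2 f (Metric.ball 0 1) ∧ ∀ z ∈ Metric.ball (0 : ℂ) 1, weightedLaplacian α f z = 0

/-- The functions `e^{iθ} ↦ f (r e^{iθ})` converge to `g` in the space of distributions on the unit
circle as `r → 1⁻`.  Test functions on the circle are the smooth `2π`-periodic functions of `θ`. -/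
def HasDistribBoundaryValue (f : ℂ → ℂ) (g : Circle → ℂ) : Prop :=
  ∀ φ : ℝ → ℂ, ContDiff ℝ ∞ φ → Function.Periodic φ (2 * Real.pi) →
    Tendsto (fun r : ℝ => ∫ θ in (0 : ℝ)..(2 * Real.pi), f (r * Circle.exp θ) * φ θ)
      (𝓝[<] 1) (𝓝 (∫ θ in (0 : ℝ)..(2 * Real.pi), g (Circle.exp θ) * φ θ))

/-- `f` solves the Dirichlet problem `Δ_α f = 0` in the unit disk, `f = g` on the unit circle, the
boundary condition being understood in the sense of distributions. -/
def SolvesDirichlet (α : ℝ) (f : ℂ → ℂ) (g : Circle → ℂ) : Prop :=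
  IsAlphaHarmonic α f ∧ HasDistribBoundaryValue f g

/-- The bound `M(r, α)`. -/
def schwarzBound (r α : ℝ) : ℝ :=
  (1 - r ^ 2) ^ (α + 1) * |(1 - r) ^ (-α) - 1| / (1 + r ^ 2) +
    (if 0 ≤ α then (2 : ℝ) ^ (2 + α / 2) else 4) * r / Real.pi * (1 + r ^ 2) ^ (α / 2 - 1) *
      ordinaryHypergeometric (1 / 2 : ℝ) (1 / 2 - α / 2) (3 / 2) (4 * r ^ 2 / (1 + r ^ 2) ^ 2)

end AlphaHarmonic

end

/-!
Writing `w = r e^{iθ}`, the theorem is the estimate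
`|f(z) - A f(0)| ≤ (1/2π) ∫ |P(r e^{iθ}) - A| dθ` for the Poisson kernel
`P(w) = (1 - |w|²)^(α+1) / ((1 - w) (1 - w̄)^(α+1))` of `Δ_α` and `A = (1 - r²)^(α+1) / (1 + r²)`,
followed by an explicit bound of the right hand side.

*Poisson representation.* If `Δ_α f = 0` then `q = (1 - |z|²)^(-α) ∂_{z̄} f` satisfies `∂_z q = 0`.
Hence the `n`-th Fourier mode of `q` on the circle of radius `r` is a multiple of `r^(-n)`, which
vanishes for `n > 0` by regularity at the origin, and the `n`-th mode of `f` solves a first order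
linear differential equation whose source is the `(n+1)`-st mode of `q`. So the modes of `f` are
`C_n A_n(r)`, where `A_n` are the Fourier coefficients of the kernel `P`
(`IsAlphaHarmonic.exists_circleMode_eq`). As `A_n(ρ) → 1` for `ρ → 1`, the number `C_n` is the limit
of the modes of `f` on the circles of radius `ρ`. Expanding `P` in its Fourier series
(`hasSum_radialCoeff`) and exchanging limit and sum, `f(z)` is the limit, as `ρ → 1`, of the
averages of `f(ρ e^{iθ}) P(z e^{-iθ})`. Since `|f| ≤ 1`, this yields the estimate
(`norm_sub_mul_le_integral`).

*The kernel.* Put `E = (1 - w̄)^(-α)`. As `1 / |1 - w|² - 1 / (1 + r²)` equals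
`2 Re w / (|1 - w|² (1 + r²))`, the difference `P - A` is `A (E - 1) + A E · 2 Re w / |1 - w|²`.
The first term is bounded by the binomial series, whose nonconstant coefficients all have the same
sign (`norm_one_sub_cpow_neg_sub_one_le`). In the second, `|1 - w|² = (1 + r²)(1 - k cos θ)` with
`k = 2r / (1 + r²)`; superposing the half circles `cos θ ≥ 0` and `cos θ ≤ 0` replaces
`(1 - k cos θ)^(-p)`, for `p = 1 + α/2`, by `(1 - k² cos² θ)^(-p)` times the maximum of
`(1 + x)^p + (1 - x)^p` on `[-1, 1]`, which is `C_α / 2`. The substitution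
`t = sin θ / √(1 - k² cos² θ)` turns the integral into
`∫₀¹ (1 - k² t²)^((α-1)/2) dt = ₂F₁(1/2, 1/2 - α/2; 3/2; k²)`, up to a power of `1 - k²` which
cancels `(1 - r²)^(α+1)`. By the same integral formula and dominated convergence, the
hypergeometric factor has a finite limit for `k → 1`, since `(α - 1)/2 > -1`.
-/

namespace AlphaHarmonic
open MeasureTheory

/-! ### The binomial series -/

theorem multichoose_eq_ascPochhammer_div (a : ℝ) (k : ℕ) :
    Ring.multichoose a k = (ascPochhammer ℝ k).eval a / (k.factorial : ℝ) := by
  have h := Ring.factorial_nsmul_multichoose_eq_ascPochhammer a k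
  rw [Polynomial.ascPochhammer_smeval_eq_eval, nsmul_eq_mul] at h
  rw [eq_div_iff (by positivity), mul_comm, h]

theorem succ_mul_multichoose (a : ℝ) (k : ℕ) :
    ((k : ℝ) + 1) * Ring.multichoose a (k + 1) = (a + k) * Ring.multichoose a k := by
  rw [multichoose_eq_ascPochhammer_div, multichoose_eq_ascPochhammer_div, ascPochhammer_succ_eval,
    Nat.factorial_succ]
  have : (k.factorial : ℝ) ≠ 0 := by positivity
  push_cast
  field_simp

theorem multichoose_pos {a : ℝ} (ha : 0 < a) (k : ℕ) : 0 < Ring.multichoose a k := by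
  rw [multichoose_eq_ascPochhammer_div]
  exact div_pos (ascPochhammer_pos k a ha) (by positivity)

theorem hasSum_one_sub_cpow_neg (a : ℝ) {w : ℂ} (hw : ‖w‖ < 1) :
    HasSum (fun k : ℕ => ((Ring.multichoose a k : ℝ) : ℂ) * w ^ k) ((1 - w) ^ (-(a : ℂ))) := by
  have h := (Complex.one_div_one_sub_cpow_hasFPowerSeriesOnBall_zero (a : ℂ)).hasSum
    (y := w) (by simpa [enorm_eq_nnnorm, ← NNReal.coe_lt_coe] using hw)
  have hc (k : ℕ) : Ring.choose ((a : ℂ) + k - 1) k = ((Ring.multichoose a k : ℝ) : ℂ) := by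
    have h1 : ((a : ℂ) + k - 1) = ((a + k - 1 : ℝ) : ℂ) := by push_cast; ring
    rw [h1, ← Complex.ofReal_choose, Ring.choose]
    congr 2
    ring
  simpa [hc, Complex.cpow_neg, mul_comm] using h

theorem hasSum_one_sub_rpow_neg (a : ℝ) {x : ℝ} (hx : |x| < 1) :
    HasSum (fun k : ℕ => Ring.multichoose a k * x ^ k) ((1 - x) ^ (-a)) := by
  have h := hasSum_one_sub_cpow_neg a (w := (x : ℂ)) (by simpa using hx)
  have h1 : (0 : ℝ) ≤ 1 - x := by linarith [(abs_lt.1 hx).2]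
  rw [← Complex.hasSum_ofReal]
  push_cast [Complex.ofReal_cpow h1]
  exact h

/-- For an exponent `-α < 1` all the nonconstant binomial coefficients of `(1 - w)^(-α)` have
the sign of `α`, so that `|(1 - w)^(-α) - 1|` is largest at `w = |w|` among the `w` of given
modulus. -/
theorem norm_one_sub_cpow_neg_sub_one_le {α : ℝ} (hα : -1 < α) {w : ℂ} (hw : ‖w‖ < 1) :
    ‖(1 - w) ^ (-(α : ℂ)) - 1‖ ≤ |(1 - ‖w‖) ^ (-α) - 1| := by
  have key : ∀ k : ℕ, |Ring.multichoose α (k + 1)| =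
      SignType.sign α * Ring.multichoose α (k + 1) := by
    rcases lt_trichotomy α 0 with h | h | h
    · have : ∀ k : ℕ, Ring.multichoose α (k + 1) < 0 := by
        intro k
        induction k with
        | zero => simpa using h
        | succ k ih =>
          have := succ_mul_multichoose α (k + 1)
          have h2 : 0 < α + ((k + 1 : ℕ) : ℝ) := by push_cast; linarith [Nat.cast_nonneg (α := ℝ) k]
          have h3 : (0 : ℝ) < ((k + 1 : ℕ) : ℝ) + 1 := by positivity
          nlinarith
      intro k
      rw [abs_of_neg (this k), sign_neg h]
      simp
    · subst h
      intro k
      have : Ring.multichoose (0 : ℝ) (k + 1) = 0 := by simp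
      simp
    · intro k
      rw [abs_of_pos (multichoose_pos h _), sign_pos h]
      simp
  have hC := (hasSum_nat_add_iff' 1).2 (hasSum_one_sub_cpow_neg α hw)
  have hR := (hasSum_nat_add_iff' 1).2
    (hasSum_one_sub_rpow_neg α (x := ‖w‖) (by simpa using hw))
  simp only [Finset.range_one, Finset.sum_singleton, Ring.multichoose_zero_right, pow_zero, mul_one,
    Complex.ofReal_one] at hC hR
  have hS := hR.mul_left ((SignType.sign α : SignType) : ℝ)
  have hle := tsum_of_norm_bounded (f := fun k : ℕ =>
    ((Ring.multichoose α (k + 1) : ℝ) : ℂ) * w ^ (k + 1)) hS (fun k => by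
      rw [norm_mul, norm_pow, Complex.norm_real, Real.norm_eq_abs, key, mul_assoc])
  rw [hC.tsum_eq] at hle
  refine hle.trans ((le_abs_self _).trans ?_)
  rw [abs_mul]
  refine mul_le_of_le_one_left (abs_nonneg _) ?_
  cases SignType.sign α <;> simp

/-! ### The Poisson kernel of the weighted Laplacian and its Fourier expansion -/

/-- The `α`-harmonic Poisson kernel `(1 - |w|²)^(α+1) / ((1 - w) (1 - w̄)^(α+1))`. -/
noncomputable def poissonKernel (α : ℝ) (w : ℂ) : ℂ :=
  (((1 - ‖w‖ ^ 2) ^ (α + 1) : ℝ) : ℂ) *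
    ((1 - w)⁻¹ * (1 - (starRingEnd ℂ) w) ^ (-((α + 1 : ℝ) : ℂ)))

/-- The `n`-th Fourier coefficient of the Poisson kernel on the circle of radius `r`: the sum of the
terms with `j - k = n` in the product of the expansions of `1 / (1 - w)` in powers `w ^ j` and of
`(1 - w̄)^(-(α+1))` in powers `w̄ ^ k`. -/
noncomputable def radialCoeff (α : ℝ) (n : ℤ) (r : ℝ) : ℝ :=
  (1 - r ^ 2) ^ (α + 1) *
    ∑' i : ℕ, Ring.multichoose (α + 1) (i + (-n).toNat) * r ^ (2 * i + n.natAbs)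

/-- The pairs `(j, k)` of natural numbers, indexed by the difference `j - k` and the minimum. -/
def diffMinEquiv : ℤ × ℕ ≃ ℕ × ℕ where
  toFun p := (p.2 + p.1.toNat, p.2 + (-p.1).toNat)
  invFun q := ((q.1 : ℤ) - q.2, min q.1 q.2)
  left_inv p := by
    obtain ⟨n, i⟩ := p
    ext <;> simp only <;> omega
  right_inv q := by
    obtain ⟨j, k⟩ := q
    ext <;> simp only <;> omega

theorem hasSum_double_expansion {α : ℝ} {r : ℝ} (hr0 : 0 ≤ r) (hr1 : r < 1) (u : Circle) :
    Summable (fun p : ℤ × ℕ => ((Ring.multichoose (α + 1) (p.2 + (-p.1).toNat) *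
        r ^ (2 * p.2 + p.1.natAbs) : ℝ) : ℂ) * (u : ℂ) ^ p.1) ∧
    HasSum (fun p : ℤ × ℕ => ((Ring.multichoose (α + 1) (p.2 + (-p.1).toNat) *
        r ^ (2 * p.2 + p.1.natAbs) : ℝ) : ℂ) * (u : ℂ) ^ p.1)
      ((1 - (r : ℂ) * u)⁻¹ * (1 - (starRingEnd ℂ) (r * u)) ^ (-((α + 1 : ℝ) : ℂ))) := by
  have hw : ‖(r * u : ℂ)‖ < 1 := by simpa [abs_of_nonneg hr0, Circle.norm_coe] using hr1
  have hw' : ‖(starRingEnd ℂ) (r * u : ℂ)‖ < 1 := by rwa [RCLike.norm_conj]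
  have h1 := hasSum_geometric_of_norm_lt_one hw
  have h2 := hasSum_one_sub_cpow_neg (α + 1) hw'
  have hs := summable_mul_of_summable_norm h1.summable.norm h2.summable.norm
  have h3 := h1.mul h2 hs
  rw [← diffMinEquiv.hasSum_iff] at h3
  have hfun : ((fun x : ℕ × ℕ => (r * u : ℂ) ^ x.1 * (((Ring.multichoose (α + 1) x.2 : ℝ) : ℂ) *
      (starRingEnd ℂ) (r * u : ℂ) ^ x.2)) ∘ diffMinEquiv) =
      fun p : ℤ × ℕ => ((Ring.multichoose (α + 1) (p.2 + (-p.1).toNat) *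
        r ^ (2 * p.2 + p.1.natAbs) : ℝ) : ℂ) * (u : ℂ) ^ p.1 := by
    funext ⟨n, i⟩
    have hu : (u : ℂ) ≠ 0 := u.coe_ne_zero
    have e1 : 2 * i + n.natAbs = (i + n.toNat) + (i + (-n).toNat) := by omega
    have e2 : n = ((i + n.toNat : ℕ) : ℤ) - ((i + (-n).toNat : ℕ) : ℤ) := by omega
    have e3 : (u : ℂ) ^ n = (u : ℂ) ^ (i + n.toNat) * ((u : ℂ)⁻¹) ^ (i + (-n).toNat) := by
      conv_lhs => rw [e2, zpow_sub₀ hu, zpow_natCast, zpow_natCast]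
      rw [inv_pow, div_eq_mul_inv]
    simp only [Function.comp, diffMinEquiv, Equiv.coe_fn_mk, map_mul, Complex.conj_ofReal]
    rw [e3, e1, ← Circle.coe_inv_eq_conj, Circle.coe_inv]
    push_cast
    ring
  rw [hfun] at h3
  exact ⟨h3.summable, h3⟩

theorem hasSum_radialCoeff {α : ℝ} {r : ℝ} (hr0 : 0 ≤ r) (hr1 : r < 1) (u : Circle) :
    HasSum (fun n : ℤ => ((radialCoeff α n r : ℝ) : ℂ) * (u : ℂ) ^ n)
      (poissonKernel α (r * u)) := by
  obtain ⟨hs, h⟩ := hasSum_double_expansion (α := α) hr0 hr1 u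
  have h4 := (h.prod_fiberwise fun n => (hs.prod_factor n).hasSum).mul_left
    (((1 - r ^ 2) ^ (α + 1) : ℝ) : ℂ)
  have hnorm : ‖(r * u : ℂ)‖ = r := by simp [abs_of_nonneg hr0, Circle.norm_coe]
  rw [poissonKernel, hnorm]
  refine h4.congr_fun fun n => ?_
  dsimp only
  rw [tsum_mul_right, ← Complex.ofReal_tsum, radialCoeff]
  push_cast
  ring

theorem radialCoeff_nonneg {α : ℝ} (hα : -1 < α) {r : ℝ} (hr0 : 0 ≤ r) (hr1 : r < 1) (n : ℤ) :
    0 ≤ radialCoeff α n r := by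
  refine mul_nonneg (Real.rpow_nonneg (by nlinarith) _) (tsum_nonneg fun i => ?_)
  exact mul_nonneg (multichoose_pos (by linarith) _).le (by positivity)

theorem summable_radialCoeff {α : ℝ} {r : ℝ} (hr0 : 0 ≤ r) (hr1 : r < 1) :
    Summable fun n : ℤ => radialCoeff α n r := by
  have h := (hasSum_radialCoeff (α := α) hr0 hr1 1).summable
  simpa [← Complex.ofReal_one] using (Complex.summable_ofReal.1 (by simpa using h))

theorem radialCoeff_natCast {α : ℝ} {r : ℝ} (hr0 : 0 ≤ r) (hr1 : r < 1) (n : ℕ) :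
    radialCoeff α n r = r ^ n := by
  have hx : |r ^ 2| < 1 := by rw [abs_of_nonneg (by positivity)]; nlinarith
  have h := (hasSum_one_sub_rpow_neg (α + 1) hx).mul_left (r ^ n)
  have hpos : 0 < 1 - r ^ 2 := by linarith [(abs_lt.1 hx).2]
  have h2 : ∑' i : ℕ, Ring.multichoose (α + 1) (i + (-(n : ℤ)).toNat) *
      r ^ (2 * i + (n : ℤ).natAbs) = r ^ n * (1 - r ^ 2) ^ (-(α + 1)) := by
    rw [← h.tsum_eq]
    refine tsum_congr fun i => ?_
    have : i + (-(n : ℤ)).toNat = i := by omega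
    rw [this, Int.natAbs_natCast, pow_add, pow_mul]
    ring
  rw [radialCoeff, h2, Real.rpow_neg hpos.le]
  have := (Real.rpow_pos_of_pos hpos (α + 1)).ne'
  field_simp

/-- The function `h_m(x) = 1 - (1 - x)^(α+1) ∑_{k<m} c_k x^k`, where `∑ c_k x^k` is the expansion of
`(1 - x)^(-(α+1))`. -/
noncomputable def tailWeight (α : ℝ) (m : ℕ) (x : ℝ) : ℝ :=
  1 - (1 - x) ^ (α + 1) * ∑ k ∈ Finset.range m, Ring.multichoose (α + 1) k * x ^ k

theorem pow_mul_radialCoeff_neg {α : ℝ} {r : ℝ} (hr0 : 0 ≤ r) (hr1 : r < 1) (m : ℕ) :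
    r ^ m * radialCoeff α (-m) r = tailWeight α m (r ^ 2) := by
  have hx : |r ^ 2| < 1 := by rw [abs_of_nonneg (by positivity)]; nlinarith
  have h := hasSum_one_sub_rpow_neg (α + 1) hx
  have hpos : 0 < 1 - r ^ 2 := by linarith [(abs_lt.1 hx).2]
  have h1 := (hasSum_nat_add_iff' m).2 h
  have h2 : r ^ m * ∑' i : ℕ, Ring.multichoose (α + 1) (i + (-(-m : ℤ)).toNat) *
      r ^ (2 * i + (-m : ℤ).natAbs) = (1 - r ^ 2) ^ (-(α + 1)) -
        ∑ k ∈ Finset.range m, Ring.multichoose (α + 1) k * (r ^ 2) ^ k := by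
    rw [← h1.tsum_eq, ← tsum_mul_left]
    refine tsum_congr fun i => ?_
    have : i + (-(-m : ℤ)).toNat = i + m := by omega
    rw [this, Int.natAbs_neg, Int.natAbs_natCast]
    ring
  rw [radialCoeff, mul_left_comm, h2, Real.rpow_neg hpos.le, tailWeight]
  have := (Real.rpow_pos_of_pos hpos (α + 1)).ne'
  field_simp

theorem tailWeight_zero {α : ℝ} {m : ℕ} (hm : m ≠ 0) : tailWeight α m 0 = 0 := by
  obtain ⟨m, rfl⟩ := Nat.exists_eq_succ_of_ne_zero hm
  simp [tailWeight, Finset.sum_range_succ']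

theorem continuousAt_tailWeight {α : ℝ} (hα : -1 < α) (m : ℕ) (x : ℝ) :
    ContinuousAt (tailWeight α m) x := by
  unfold tailWeight
  have : ContinuousAt (fun x : ℝ => (1 - x) ^ (α + 1)) x :=
    ContinuousAt.rpow_const (by fun_prop) (Or.inr (by linarith))
  fun_prop

/-- The sum defining `tailWeight` telescopes on differentiation, because
`(k + 1) c_{k+1} = (α + 1 + k) c_k`. -/
theorem hasDerivAt_tailWeight (α : ℝ) (m : ℕ) {x : ℝ} (hx : x < 1) :
    HasDerivAt (tailWeight α (m + 1))
      ((m + 1) * Ring.multichoose (α + 1) (m + 1) * x ^ m * (1 - x) ^ α) x := by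
  have hpos : 0 < 1 - x := by linarith
  have hbase : HasDerivAt (fun x : ℝ => (1 - x) ^ (α + 1)) (-(α + 1) * (1 - x) ^ α) x := by
    have := ((hasDerivAt_id x).const_sub 1).rpow_const (p := α + 1) (Or.inl hpos.ne')
    simpa using this
  have hstep : (1 - x) ^ (α + 1) = (1 - x) ^ α * (1 - x) := by
    rw [Real.rpow_add hpos, Real.rpow_one]
  induction m with
  | zero =>
    have := hbase.const_sub 1
    have h1 : tailWeight α (0 + 1) = fun x => 1 - (1 - x) ^ (α + 1) := by
      funext x; simp [tailWeight]
    rw [h1]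
    exact this.congr_deriv (by simp; ring)
  | succ m ih =>
    have h1 : tailWeight α (m + 1 + 1) = fun x => tailWeight α (m + 1) x -
        (1 - x) ^ (α + 1) * (Ring.multichoose (α + 1) (m + 1) * x ^ (m + 1)) := by
      funext x
      rw [tailWeight, tailWeight, Finset.sum_range_succ]
      ring
    rw [h1]
    have h2 := ih.sub (hbase.mul ((hasDerivAt_pow (m + 1) x).const_mul
      (Ring.multichoose (α + 1) (m + 1))))
    refine h2.congr_deriv ?_
    rw [hstep]
    have h3 := succ_mul_multichoose (α + 1) (m + 1)
    push_cast at h3 ⊢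
    linear_combination (-(1 - x) ^ α * x ^ (m + 1)) * h3

theorem tendsto_radialCoeff {α : ℝ} (hα : -1 < α) (n : ℤ) :
    Tendsto (radialCoeff α n) (𝓝[<] 1) (𝓝 1) := by
  have hev : ∀ᶠ r : ℝ in 𝓝[<] 1, r ∈ Set.Ioo (0 : ℝ) 1 := Ioo_mem_nhdsLT (by norm_num)
  have hid : Tendsto (fun r : ℝ => r) (𝓝[<] 1) (𝓝 1) :=
    tendsto_nhdsWithin_of_tendsto_nhds tendsto_id
  obtain ⟨m, rfl | rfl⟩ := n.eq_nat_or_neg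
  · have h : Tendsto (fun r : ℝ => r ^ m) (𝓝[<] 1) (𝓝 1) := by simpa using hid.pow m
    refine h.congr' ?_
    filter_upwards [hev] with r hr
    rw [radialCoeff_natCast hr.1.le hr.2]
  · have h1 : Tendsto (fun r : ℝ => tailWeight α m (r ^ 2)) (𝓝[<] 1) (𝓝 1) := by
      have h2 : tailWeight α m 1 = 1 := by
        simp [tailWeight, Real.zero_rpow (by linarith : α + 1 ≠ 0)]
      have h3 := (continuousAt_tailWeight hα m 1).tendsto
      rw [h2] at h3
      exact h3.comp (by simpa using hid.pow 2)
    have h : Tendsto (fun r : ℝ => tailWeight α m (r ^ 2) / r ^ m) (𝓝[<] 1) (𝓝 1) := by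
      have := h1.div (hid.pow m) (by simp)
      rw [one_pow, div_one] at this
      exact this
    refine h.congr' ?_
    filter_upwards [hev] with r hr
    rw [← pow_mul_radialCoeff_neg hr.1.le hr.2, mul_div_cancel_left₀ _ (pow_pos hr.1 m).ne']

/-! ### Fourier modes on concentric circles -/

/-- `2π` times the `n`-th Fourier coefficient of `θ ↦ f (r e^{iθ})`. -/
noncomputable def circleMode (f : ℂ → ℂ) (n : ℤ) (r : ℝ) : ℂ :=
  ∫ θ in (0 : ℝ)..(2 * Real.pi), f (r * Circle.exp θ) * (Circle.exp θ : ℂ) ^ (-n)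

theorem fderiv_apply_eq_dz_dzbar (f : ℂ → ℂ) (z v : ℂ) :
    fderiv ℝ f z v = dz f z * v + dzbar f z * (starRingEnd ℂ) v := by
  have hv : v = (v.re : ℝ) • (1 : ℂ) + (v.im : ℝ) • Complex.I := by
    simp [Complex.re_add_im]
  conv_lhs => rw [hv, map_add, map_smul, map_smul]
  have h1 : v = v.re + v.im * Complex.I := (Complex.re_add_im v).symm
  have h2 : (starRingEnd ℂ) v = v.re - v.im * Complex.I := by
    conv_lhs => rw [h1, map_add, map_mul, Complex.conj_I, Complex.conj_ofReal, Complex.conj_ofReal]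
    ring
  rw [h2]
  conv_rhs => rw [h1]
  simp only [dz, dzbar, Complex.real_smul, Complex.add_re, Complex.ofReal_re, Complex.mul_re,
    Complex.I_re, mul_zero, Complex.ofReal_im, Complex.I_im, mul_one, sub_self, add_zero,
    Complex.add_im, Complex.mul_im, zero_add]
  linear_combination ((v.im : ℂ) * fderiv ℝ f z Complex.I) * Complex.I_sq

theorem continuous_circleExp_zpow (n : ℤ) : Continuous fun θ : ℝ => (Circle.exp θ : ℂ) ^ n :=
  Continuous.zpow₀ (by fun_prop) n fun θ => Or.inl (Circle.exp θ).coe_ne_zero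

theorem mem_ball_of_abs_lt {r : ℝ} (hr : |r| < 1) (u : Circle) :
    (r * u : ℂ) ∈ Metric.ball (0 : ℂ) 1 := by
  simpa [Circle.norm_coe] using hr

theorem continuous_comp_circle {f : ℂ → ℂ} (hf : ContinuousOn f (Metric.ball 0 1)) {r : ℝ}
    (hr : |r| < 1) : Continuous fun θ : ℝ => f (r * Circle.exp θ) :=
  hf.comp_continuous (by fun_prop) fun θ => mem_ball_of_abs_lt hr _

theorem hasDerivAt_circleExp_zpow (n : ℤ) (θ : ℝ) :
    HasDerivAt (fun θ : ℝ => (Circle.exp θ : ℂ) ^ n)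
      (n * Complex.I * (Circle.exp θ : ℂ) ^ n) θ := by
  have h : (fun θ : ℝ => (Circle.exp θ : ℂ) ^ n) =
      fun θ : ℝ => Complex.exp (n * (θ * Complex.I)) := by
    funext θ
    rw [Circle.coe_exp, Complex.exp_int_mul]
  have h2 : (Circle.exp θ : ℂ) ^ n = Complex.exp (n * (θ * Complex.I)) := congrFun h θ
  rw [h, h2]
  have h3 : HasDerivAt (fun θ : ℝ => (n * (θ * Complex.I) : ℂ)) (n * (1 * Complex.I)) θ :=
    ((Complex.ofRealCLM.hasDerivAt (x := θ)).mul_const Complex.I).const_mul (n : ℂ)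
  exact h3.cexp.congr_deriv (by ring)

theorem hasDerivAt_circleExp (θ : ℝ) :
    HasDerivAt (fun θ : ℝ => (Circle.exp θ : ℂ)) (Complex.I * Circle.exp θ) θ := by
  simpa using hasDerivAt_circleExp_zpow 1 θ

section Modes

variable {h : ℂ → ℂ}

theorem continuousOn_dz (hh : ContDiffOn ℝ 1 h (Metric.ball 0 1)) :
    ContinuousOn (dz h) (Metric.ball 0 1) := by
  have := hh.continuousOn_fderiv_of_isOpen Metric.isOpen_ball le_rfl
  unfold dz
  fun_prop

theorem continuousOn_dzbar (hh : ContDiffOn ℝ 1 h (Metric.ball 0 1)) :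
    ContinuousOn (dzbar h) (Metric.ball 0 1) := by
  have := hh.continuousOn_fderiv_of_isOpen Metric.isOpen_ball le_rfl
  unfold dzbar
  fun_prop

theorem intervalIntegrable_circleMode {g : ℂ → ℂ} (hg : ContinuousOn g (Metric.ball 0 1)) (n : ℤ)
    {r : ℝ} (hr : |r| < 1) (a b : ℝ) :
    IntervalIntegrable (fun θ : ℝ => g (r * Circle.exp θ) * (Circle.exp θ : ℂ) ^ n) volume a b :=
  ((continuous_comp_circle hg hr).mul (continuous_circleExp_zpow n)).intervalIntegrable a b

theorem hasFDerivAt_of_contDiffOn_ball (hh : ContDiffOn ℝ 1 h (Metric.ball 0 1)) {z : ℂ}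
    (hz : z ∈ Metric.ball (0 : ℂ) 1) : HasFDerivAt h (fderiv ℝ h z) z :=
  ((hh.contDiffAt (Metric.isOpen_ball.mem_nhds hz)).differentiableAt (by simp)).hasFDerivAt

/-- Multiplying `∂_z h` by `e^{iθ}` or `∂_{z̄} h` by `e^{-iθ}` shifts the index of the Fourier
modes, so that differentiation in `r` relates neighbouring modes. -/
theorem hasDerivAt_circleMode (hh : ContDiffOn ℝ 1 h (Metric.ball 0 1)) (n : ℤ) {r : ℝ}
    (hr : |r| < 1) :
    HasDerivAt (circleMode h n)
      (circleMode (dz h) (n - 1) r + circleMode (dzbar h) (n + 1) r) r := by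
  obtain ⟨R, hrR, hR1⟩ := exists_between hr
  have hcont := hh.continuousOn_fderiv_of_isOpen Metric.isOpen_ball le_rfl
  have hsub : Metric.closedBall (0 : ℂ) R ⊆ Metric.ball 0 1 := Metric.closedBall_subset_ball hR1
  obtain ⟨M, hM⟩ := (isCompact_closedBall (0 : ℂ) R).exists_bound_of_continuousOn (hcont.mono hsub)
  have hs : {x : ℝ | |x| < R} ∈ 𝓝 r := (isOpen_lt continuous_abs continuous_const).mem_nhds hrR
  have hkey := intervalIntegral.hasDerivAt_integral_of_dominated_loc_of_deriv_le
    (μ := volume) (a := 0) (b := 2 * Real.pi) (x₀ := r) (s := {x : ℝ | |x| < R})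
    (F := fun (r : ℝ) (θ : ℝ) => h (r * Circle.exp θ) * (Circle.exp θ : ℂ) ^ (-n))
    (F' := fun (r : ℝ) (θ : ℝ) =>
      fderiv ℝ h (r * Circle.exp θ) (Circle.exp θ) * (Circle.exp θ : ℂ) ^ (-n))
    (bound := fun _ => M) hs ?_
    (intervalIntegrable_circleMode hh.continuousOn _ hr _ _) ?_ ?_ intervalIntegrable_const ?_
  · refine hkey.2.congr_deriv ?_
    rw [circleMode, circleMode, ← intervalIntegral.integral_add
      (intervalIntegrable_circleMode (continuousOn_dz hh) _ hr _ _)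
      (intervalIntegrable_circleMode (continuousOn_dzbar hh) _ hr _ _)]
    refine intervalIntegral.integral_congr fun θ _ => ?_
    have hu : (Circle.exp θ : ℂ) ≠ 0 := (Circle.exp θ).coe_ne_zero
    have e1 : (Circle.exp θ : ℂ) ^ (-(n - 1)) = Circle.exp θ * (Circle.exp θ : ℂ) ^ (-n) := by
      rw [← zpow_one_add₀ hu]; congr 1; ring
    have e2 : (Circle.exp θ : ℂ) ^ (-(n + 1)) =
        (Circle.exp θ : ℂ)⁻¹ * (Circle.exp θ : ℂ) ^ (-n) := by
      rw [← zpow_neg_one, ← zpow_add₀ hu]; congr 1; ring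
    rw [fderiv_apply_eq_dz_dzbar, e1, e2, ← Circle.coe_inv_eq_conj, Circle.coe_inv]
    ring
  · filter_upwards [hs] with x hx
    exact ((continuous_comp_circle hh.continuousOn (lt_trans hx hR1)).mul
      (continuous_circleExp_zpow _)).aestronglyMeasurable
  · have : Continuous fun θ : ℝ => fderiv ℝ h (r * Circle.exp θ) :=
      hcont.comp_continuous (by fun_prop) fun θ => mem_ball_of_abs_lt hr _
    exact ((this.clm_apply (by fun_prop)).mul (continuous_circleExp_zpow _)).aestronglyMeasurable
  · refine ae_of_all _ fun θ _ x hx => ?_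
    have h1 := hM (x * Circle.exp θ) (by simpa [Circle.norm_coe] using le_of_lt hx)
    have h2 := (fderiv ℝ h (x * Circle.exp θ)).le_opNorm (Circle.exp θ : ℂ)
    rw [Circle.norm_coe, mul_one] at h2
    simpa [Circle.norm_coe] using h2.trans h1
  · refine ae_of_all _ fun θ _ x hx => ?_
    have h1 := hasFDerivAt_of_contDiffOn_ball hh
      (mem_ball_of_abs_lt (lt_trans hx hR1) (Circle.exp θ))
    have h2 : HasDerivAt (fun x : ℝ => (x * Circle.exp θ : ℂ)) (1 * Circle.exp θ) x :=
      (Complex.ofRealCLM.hasDerivAt (x := x)).mul_const _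
    rw [one_mul] at h2
    exact (h1.comp_hasDerivAt x h2).mul_const _

/-- Integration by parts in `θ`. -/
theorem int_mul_circleMode (hh : ContDiffOn ℝ 1 h (Metric.ball 0 1)) (n : ℤ) {r : ℝ}
    (hr : |r| < 1) :
    n * circleMode h n r =
      r * (circleMode (dz h) (n - 1) r - circleMode (dzbar h) (n + 1) r) := by
  have hd : ∀ θ ∈ Set.uIcc (0 : ℝ) (2 * Real.pi),
      HasDerivAt (fun θ : ℝ => h (r * Circle.exp θ) * (Circle.exp θ : ℂ) ^ (-n))
      (Complex.I * (r * (dz h (r * Circle.exp θ) * (Circle.exp θ : ℂ) ^ (-(n - 1))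
        - dzbar h (r * Circle.exp θ) * (Circle.exp θ : ℂ) ^ (-(n + 1)))
        - n * (h (r * Circle.exp θ) * (Circle.exp θ : ℂ) ^ (-n)))) θ := by
    intro θ _
    have h1 := hasFDerivAt_of_contDiffOn_ball hh (mem_ball_of_abs_lt hr (Circle.exp θ))
    have h2 := h1.comp_hasDerivAt θ ((hasDerivAt_circleExp θ).const_mul (r : ℂ))
    refine (h2.mul (hasDerivAt_circleExp_zpow (-n) θ)).congr_deriv ?_
    have hu : (Circle.exp θ : ℂ) ≠ 0 := (Circle.exp θ).coe_ne_zero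
    have e1 : (Circle.exp θ : ℂ) ^ (-(n - 1)) = Circle.exp θ * (Circle.exp θ : ℂ) ^ (-n) := by
      rw [← zpow_one_add₀ hu]; congr 1; ring
    have e2 : (Circle.exp θ : ℂ) ^ (-(n + 1)) =
        (Circle.exp θ : ℂ)⁻¹ * (Circle.exp θ : ℂ) ^ (-n) := by
      rw [← zpow_neg_one, ← zpow_add₀ hu]; congr 1; ring
    rw [fderiv_apply_eq_dz_dzbar, e1, e2, map_mul, map_mul, ← Circle.coe_inv_eq_conj,
      Circle.coe_inv, Complex.conj_I, Complex.conj_ofReal]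
    push_cast
    simp only [Function.comp]
    ring
  have i1 := intervalIntegrable_circleMode (continuousOn_dz hh) (-(n - 1)) hr 0 (2 * Real.pi)
  have i2 := intervalIntegrable_circleMode (continuousOn_dzbar hh) (-(n + 1)) hr 0 (2 * Real.pi)
  have i3 := intervalIntegrable_circleMode hh.continuousOn (-n) hr 0 (2 * Real.pi)
  have h0 := intervalIntegral.integral_eq_sub_of_hasDerivAt hd
    ((((i1.sub i2).const_mul (r : ℂ)).sub (i3.const_mul (n : ℂ))).const_mul Complex.I)
  rw [intervalIntegral.integral_const_mul, intervalIntegral.integral_sub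
    ((i1.sub i2).const_mul (r : ℂ)) (i3.const_mul (n : ℂ)), intervalIntegral.integral_const_mul,
    intervalIntegral.integral_const_mul, intervalIntegral.integral_sub i1 i2,
    Circle.exp_two_pi, Circle.exp_zero, sub_self] at h0
  have h1 := (mul_eq_zero.1 h0).resolve_left Complex.I_ne_zero
  exact (sub_eq_zero.1 h1).symm

theorem exists_eq_of_hasDerivAt_zero {g : ℝ → ℂ}
    (hg : ∀ r ∈ Set.Ioo (0 : ℝ) 1, HasDerivAt g 0 r) :
    ∃ c, ∀ r ∈ Set.Ioo (0 : ℝ) 1, g r = c := by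
  refine ⟨g (1 / 2), fun r hr => ?_⟩
  exact isOpen_Ioo.is_const_of_deriv_eq_zero isPreconnected_Ioo
    (fun x hx => (hg x hx).differentiableAt.differentiableWithinAt)
    (fun x hx => (hg x hx).deriv) hr (by constructor <;> norm_num)

theorem abs_lt_one_of_mem_Ioo {r : ℝ} (hr : r ∈ Set.Ioo (0 : ℝ) 1) : |r| < 1 := by
  rw [abs_of_pos hr.1]; exact hr.2

theorem hasDerivAt_ofReal_zpow (n : ℤ) {r : ℝ} (hr : r ≠ 0) :
    HasDerivAt (fun r : ℝ => (r : ℂ) ^ n) (n * (r : ℂ) ^ (n - 1)) r :=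
  (hasDerivAt_zpow n (r : ℂ) (Or.inl (by exact_mod_cast hr))).comp_ofReal

theorem tendsto_circleMode_zero (hh : ContDiffOn ℝ 1 h (Metric.ball 0 1)) (n : ℤ) :
    Tendsto (circleMode h n) (𝓝[>] 0) (𝓝 (circleMode h n 0)) :=
  tendsto_nhdsWithin_of_tendsto_nhds
    (hasDerivAt_circleMode hh n (by simp)).continuousAt.tendsto

theorem tendsto_pow_mul_circleMode_zero (hh : ContDiffOn ℝ 1 h (Metric.ball 0 1)) (n : ℤ) {m : ℕ}
    (hm : m ≠ 0) : Tendsto (fun r : ℝ => (r : ℂ) ^ m * circleMode h n r) (𝓝[>] 0) (𝓝 0) := by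
  have h1 : Tendsto (fun r : ℝ => (r : ℂ) ^ m) (𝓝[>] 0) (𝓝 0) := by
    have : ContinuousAt (fun r : ℝ => (r : ℂ) ^ m) 0 := by fun_prop
    have := tendsto_nhdsWithin_of_tendsto_nhds (s := Set.Ioi 0) this.tendsto
    simpa [hm] using this
  simpa using h1.mul (tendsto_circleMode_zero hh n)

/-- If `∂_z h = 0` then the `n`-th mode of `h` is a multiple of `r^(-n)`. -/
theorem exists_circleMode_of_dz_eq_zero (hh : ContDiffOn ℝ 1 h (Metric.ball 0 1))
    (hz : ∀ z ∈ Metric.ball (0 : ℂ) 1, dz h z = 0) (n : ℤ) :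
    ∃ c, ∀ r ∈ Set.Ioo (0 : ℝ) 1, (r : ℂ) ^ n * circleMode h n r = c := by
  refine exists_eq_of_hasDerivAt_zero fun r hr => ?_
  have hr' := abs_lt_one_of_mem_Ioo hr
  have hr0 : (r : ℂ) ≠ 0 := by exact_mod_cast hr.1.ne'
  have h0 : circleMode (dz h) (n - 1) r = 0 := by
    simp only [circleMode, hz _ (mem_ball_of_abs_lt hr' _), zero_mul,
      intervalIntegral.integral_zero]
  have h1 := hasDerivAt_circleMode hh n hr'
  have h2 := int_mul_circleMode hh n hr'
  rw [h0] at h1 h2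
  refine ((hasDerivAt_ofReal_zpow n hr.1.ne').mul h1).congr_deriv ?_
  have : (r : ℂ) ^ n = (r : ℂ) ^ (n - 1) * r := by
    rw [← zpow_add_one₀ hr0]; congr 1; ring
  rw [this]
  linear_combination (r : ℂ) ^ (n - 1) * h2

theorem circleMode_eq_zero_of_dz_eq_zero (hh : ContDiffOn ℝ 1 h (Metric.ball 0 1))
    (hz : ∀ z ∈ Metric.ball (0 : ℂ) 1, dz h z = 0) (n : ℕ) {r : ℝ} (hr : r ∈ Set.Ioo (0 : ℝ) 1) :
    circleMode h (n + 1) r = 0 := by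
  obtain ⟨c, hc⟩ := exists_circleMode_of_dz_eq_zero hh hz (n + 1)
  have hc0 : c = 0 := by
    refine tendsto_nhds_unique (f := fun _ : ℝ => c) (l := 𝓝[>] (0 : ℝ)) tendsto_const_nhds ?_
    refine (tendsto_pow_mul_circleMode_zero hh (n + 1) n.succ_ne_zero).congr' ?_
    filter_upwards [Ioo_mem_nhdsGT (zero_lt_one' ℝ)] with x hx
    rw [← hc x hx]
    norm_cast
  have hr0 : (r : ℂ) ≠ 0 := by exact_mod_cast hr.1.ne'
  have := hc r hr
  rw [hc0] at this
  exact (mul_eq_zero.1 this).resolve_left (zpow_ne_zero _ hr0)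

end Modes

/-! ### Fourier modes of `α`-harmonic functions -/

theorem contDiffOn_weight (α : ℝ) :
    ContDiffOn ℝ 1 (fun w : ℂ => (((1 - ‖w‖ ^ 2) ^ (-α) : ℝ) : ℂ)) (Metric.ball 0 1) := by
  refine Complex.ofRealCLM.contDiff.comp_contDiffOn ?_
  refine ContDiffOn.rpow_const_of_ne ?_ ?_
  · exact (contDiff_const.sub (contDiff_norm_sq ℝ)).contDiffOn
  · intro w hw
    have : ‖w‖ < 1 := by simpa using hw
    nlinarith [norm_nonneg w]

theorem contDiffOn_weight_mul_dzbar (α : ℝ) {f : ℂ → ℂ}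
    (hf : ContDiffOn ℝ 2 f (Metric.ball 0 1)) :
    ContDiffOn ℝ 1 (fun w : ℂ => (((1 - ‖w‖ ^ 2) ^ (-α) : ℝ) : ℂ) * dzbar f w)
      (Metric.ball 0 1) := by
  have h1 : ContDiffOn ℝ 1 (fderiv ℝ f) (Metric.ball 0 1) :=
    hf.fderiv_of_isOpen Metric.isOpen_ball (by norm_num)
  refine (contDiffOn_weight α).mul ?_
  unfold dzbar
  exact contDiffOn_const.mul ((h1.clm_apply contDiffOn_const).add
    (contDiffOn_const.mul (h1.clm_apply contDiffOn_const)))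

/-- The Fourier modes of an `α`-harmonic function are determined up to a multiplicative constant:
`(1 - |z|²)^(-α) ∂_{z̄} f` is antiholomorphic, which turns the equation for the `n`-th mode into a
first order linear differential equation. -/
theorem IsAlphaHarmonic.exists_circleMode_eq {α : ℝ} (hα : -1 < α) {f : ℂ → ℂ}
    (hf : IsAlphaHarmonic α f) (n : ℤ) :
    ∃ C : ℂ, ∀ r ∈ Set.Ioo (0 : ℝ) 1, circleMode f n r = (radialCoeff α n r : ℂ) * C := by
  obtain ⟨hf2, hfz⟩ := hf
  have hf1 : ContDiffOn ℝ 1 f (Metric.ball 0 1) := hf2.of_le (by norm_num)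
  set q : ℂ → ℂ := fun w => (((1 - ‖w‖ ^ 2) ^ (-α) : ℝ) : ℂ) * dzbar f w with hq
  have hq1 : ContDiffOn ℝ 1 q (Metric.ball 0 1) := contDiffOn_weight_mul_dzbar α hf2
  have hqz : ∀ z ∈ Metric.ball (0 : ℂ) 1, dz q z = 0 := hfz
  have hmode : ∀ k : ℤ, ∀ r ∈ Set.Ioo (0 : ℝ) 1,
      circleMode (dzbar f) k r = (((1 - r ^ 2) ^ α : ℝ) : ℂ) * circleMode q k r := by
    intro k r hr
    have hpos : 0 < 1 - r ^ 2 := by nlinarith [hr.1, hr.2]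
    rw [circleMode, circleMode, ← intervalIntegral.integral_const_mul]
    refine intervalIntegral.integral_congr fun θ _ => ?_
    have hn : ‖(r * Circle.exp θ : ℂ)‖ = r := by simp [abs_of_pos hr.1]
    have hmul : (((1 - r ^ 2) ^ α : ℝ) : ℂ) * (((1 - r ^ 2) ^ (-α) : ℝ) : ℂ) = 1 := by
      rw [← Complex.ofReal_mul, ← Real.rpow_add hpos]; simp
    simp only [hq, hn]
    linear_combination (-dzbar f (r * Circle.exp θ) * (Circle.exp θ : ℂ) ^ (-k)) * hmul
  -- `r F' = n F + 2 r (1 - r²)^α Q` for the `n`-th mode `F` of `f` and the `(n+1)`-st mode `Q` of `q`.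
  have hode : ∀ r ∈ Set.Ioo (0 : ℝ) 1, ∃ d, HasDerivAt (circleMode f n) d r ∧
      r * d = n * circleMode f n r +
        2 * r * (((1 - r ^ 2) ^ α : ℝ) : ℂ) * circleMode q (n + 1) r := by
    intro r hr
    have hr' := abs_lt_one_of_mem_Ioo hr
    refine ⟨_, hasDerivAt_circleMode hf1 n hr', ?_⟩
    have h1 := int_mul_circleMode hf1 n hr'
    rw [h1, hmode _ r hr]
    ring
  obtain ⟨m, rfl⟩ | ⟨m, rfl⟩ : (∃ m : ℕ, n = m) ∨ ∃ m : ℕ, n = -((m + 1 : ℕ) : ℤ) := by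
    rcases le_or_gt 0 n with h | h
    · exact Or.inl ⟨n.toNat, by omega⟩
    · exact Or.inr ⟨(-n - 1).toNat, by omega⟩
  · have hconst : ∀ r ∈ Set.Ioo (0 : ℝ) 1,
        HasDerivAt (fun r : ℝ => (r : ℂ) ^ (-m : ℤ) * circleMode f m r) 0 r := by
      intro r hr
      have hr0 : (r : ℂ) ≠ 0 := by exact_mod_cast hr.1.ne'
      obtain ⟨d, hd, hd'⟩ := hode r hr
      rw [circleMode_eq_zero_of_dz_eq_zero hq1 hqz m hr, mul_zero, add_zero] at hd'
      refine ((hasDerivAt_ofReal_zpow (-m) hr.1.ne').mul hd).congr_deriv ?_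
      have : (r : ℂ) ^ (-m : ℤ) = (r : ℂ) ^ (-m - 1 : ℤ) * r := by
        rw [← zpow_add_one₀ hr0]; congr 1; ring
      rw [this]
      push_cast at hd' ⊢
      linear_combination (r : ℂ) ^ (-m - 1 : ℤ) * hd'
    obtain ⟨C, hC⟩ := exists_eq_of_hasDerivAt_zero hconst
    refine ⟨C, fun r hr => ?_⟩
    have hr0 : (r : ℂ) ≠ 0 := by exact_mod_cast hr.1.ne'
    rw [radialCoeff_natCast hr.1.le hr.2, ← hC r hr, zpow_neg, zpow_natCast]
    push_cast
    field_simp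
  · obtain ⟨c, hc⟩ := exists_circleMode_of_dz_eq_zero hq1 hqz (-(m : ℤ))
    set b : ℝ := (m + 1) * Ring.multichoose (α + 1) (m + 1) with hb
    have hb0 : (b : ℂ) ≠ 0 := by
      have := multichoose_pos (a := α + 1) (by linarith) (m + 1)
      exact_mod_cast (by positivity : b ≠ 0)
    -- Both terms of `g` have the same derivative, so `g` is constant; it tends to `0` at `0`.
    set g : ℝ → ℂ := fun r => (r : ℂ) ^ (m + 1) * circleMode f (-((m + 1 : ℕ) : ℤ)) r -
      c / b * (tailWeight α (m + 1) (r ^ 2) : ℂ) with hg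
    have hconst : ∀ r ∈ Set.Ioo (0 : ℝ) 1, HasDerivAt g 0 r := by
      intro r hr
      have hr0 : (r : ℂ) ≠ 0 := by exact_mod_cast hr.1.ne'
      obtain ⟨d, hd, hd'⟩ := hode r hr
      have hqr : circleMode q (-((m + 1 : ℕ) : ℤ) + 1) r = c * (r : ℂ) ^ m := by
        have h1 : (-((m + 1 : ℕ) : ℤ) + 1) = -(m : ℤ) := by push_cast; ring
        rw [h1, ← hc r hr, zpow_neg, zpow_natCast]
        field_simp
      rw [hqr] at hd'
      have h1 : HasDerivAt (fun r : ℝ => (r : ℂ) ^ (m + 1)) ((m + 1 : ℕ) * (r : ℂ) ^ m) r :=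
        (hasDerivAt_pow (m + 1) (r : ℂ)).comp_ofReal
      have h2 : HasDerivAt (fun r : ℝ => tailWeight α (m + 1) (r ^ 2))
          (b * (r ^ 2) ^ m * (1 - r ^ 2) ^ α * (2 * r)) r := by
        have h3 := hasDerivAt_tailWeight α m (x := r ^ 2) (by nlinarith [hr.1, hr.2])
        have h4 : HasDerivAt (fun r : ℝ => r ^ 2) (2 * r) r := by simpa using hasDerivAt_pow 2 r
        exact HasDerivAt.comp (h₂ := tailWeight α (m + 1)) (h := fun r => r ^ 2) r h3 h4
      refine ((h1.mul hd).sub (h2.ofReal_comp.const_mul (c / b : ℂ))).congr_deriv ?_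
      push_cast at hd' ⊢
      have h4 : c / b * (b * ((r : ℂ) ^ 2) ^ m * (((1 - r ^ 2) ^ α : ℝ) : ℂ) * (2 * r)) =
          c * ((r : ℂ) ^ 2) ^ m * (((1 - r ^ 2) ^ α : ℝ) : ℂ) * (2 * r) := by
        field_simp
      rw [h4]
      linear_combination (r : ℂ) ^ m * hd'
    obtain ⟨C, hC⟩ := exists_eq_of_hasDerivAt_zero hconst
    have hC0 : C = 0 := by
      refine tendsto_nhds_unique (f := fun _ : ℝ => C) (l := 𝓝[>] (0 : ℝ)) tendsto_const_nhds ?_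
      have h1 := tendsto_pow_mul_circleMode_zero hf1 (-((m + 1 : ℕ) : ℤ)) m.succ_ne_zero
      have h2 : Tendsto (fun r : ℝ => (tailWeight α (m + 1) (r ^ 2) : ℂ)) (𝓝[>] 0) (𝓝 0) := by
        have h3 : ContinuousAt (fun r : ℝ => tailWeight α (m + 1) (r ^ 2)) 0 :=
          ContinuousAt.comp (g := tailWeight α (m + 1)) (continuousAt_tailWeight hα (m + 1) _)
            (by fun_prop)
        have h4 := tendsto_nhdsWithin_of_tendsto_nhds (s := Set.Ioi 0) h3.tendsto
        rw [zero_pow two_ne_zero, tailWeight_zero m.succ_ne_zero] at h4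
        exact_mod_cast (Complex.continuous_ofReal.tendsto 0).comp h4
      have h5 := h1.sub (h2.const_mul (c / b : ℂ))
      rw [mul_zero, sub_zero] at h5
      refine h5.congr' ?_
      filter_upwards [Ioo_mem_nhdsGT (zero_lt_one' ℝ)] with x hx
      exact hC x hx
    refine ⟨c / b, fun r hr => ?_⟩
    have hr0 : (r : ℂ) ≠ 0 := by exact_mod_cast hr.1.ne'
    have h1 := hC r hr
    rw [hC0, hg] at h1
    simp only [← pow_mul_radialCoeff_neg hr.1.le hr.2] at h1
    refine mul_left_cancel₀ (pow_ne_zero (m + 1) hr0) ?_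
    push_cast at h1 ⊢
    linear_combination h1

/-! ### The Poisson integral and the resulting estimate -/

theorem one_sub_mem_slitPlane {w : ℂ} (hw : ‖w‖ < 1) : 1 - w ∈ Complex.slitPlane := by
  simpa [sub_eq_add_neg] using
    Complex.mem_slitPlane_of_norm_lt_one (z := -w) (by simpa using hw)

theorem one_sub_ne_zero {w : ℂ} (hw : ‖w‖ < 1) : 1 - w ≠ 0 :=
  Complex.slitPlane_ne_zero (one_sub_mem_slitPlane hw)

theorem continuousOn_poissonKernel (α : ℝ) :
    ContinuousOn (poissonKernel α) (Metric.ball 0 1) := by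
  intro w hw
  have hw1 : ‖w‖ < 1 := by simpa using hw
  have hw2 : ‖(starRingEnd ℂ) w‖ < 1 := by rwa [RCLike.norm_conj]
  refine ContinuousAt.continuousWithinAt ?_
  unfold poissonKernel
  have h1 : ContinuousAt (fun w : ℂ => (1 - ‖w‖ ^ 2) ^ (α + 1)) w :=
    ContinuousAt.rpow_const (by fun_prop) (Or.inl (by nlinarith [norm_nonneg w]))
  have h2 : ContinuousAt (fun w : ℂ => (1 - w)⁻¹) w :=
    ContinuousAt.inv₀ (by fun_prop) (one_sub_ne_zero hw1)
  have h3 : ContinuousAt (fun w : ℂ => (1 - (starRingEnd ℂ) w) ^ (-((α + 1 : ℝ) : ℂ))) w :=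
    (continuousAt_const.sub Complex.continuous_conj.continuousAt).cpow continuousAt_const
      (one_sub_mem_slitPlane hw2)
  exact (Complex.continuous_ofReal.continuousAt.comp h1).mul (h2.mul h3)

theorem norm_circleMode_le {f : ℂ → ℂ} (hf : ∀ z ∈ Metric.ball (0 : ℂ) 1, ‖f z‖ ≤ 1) (n : ℤ)
    {r : ℝ} (hr : |r| < 1) : ‖circleMode f n r‖ ≤ 2 * Real.pi := by
  have := intervalIntegral.norm_integral_le_of_norm_le_const (C := 1) (a := 0) (b := 2 * Real.pi)
    (f := fun θ : ℝ => f (r * Circle.exp θ) * (Circle.exp θ : ℂ) ^ (-n)) fun θ _ => by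
      simpa [Circle.norm_coe] using hf _ (mem_ball_of_abs_lt hr (Circle.exp θ))
  simpa [circleMode, abs_of_pos Real.pi_pos] using this

theorem circleMode_zero_zero (f : ℂ → ℂ) : circleMode f 0 0 = 2 * Real.pi * f 0 := by
  simp [circleMode]

/-- A continuous function on a circle is the sum of its Fourier series if the latter converges
absolutely. -/
theorem hasSum_circleMode {f : ℂ → ℂ} (hf : ContinuousOn f (Metric.ball 0 1)) {r : ℝ}
    (hr : |r| < 1) (hs : Summable fun n : ℤ => circleMode f n r) (θ : ℝ) :
    HasSum (fun n : ℤ => circleMode f n r * (Circle.exp θ : ℂ) ^ n)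
      (2 * Real.pi * f (r * Circle.exp θ)) := by
  have : Fact (0 < 2 * Real.pi) := ⟨Real.two_pi_pos⟩
  have hpi : (2 * Real.pi : ℂ) ≠ 0 := by exact_mod_cast Real.two_pi_pos.ne'
  have hexp (x : ℝ) : AddCircle.toCircle (x : AddCircle (2 * Real.pi)) = Circle.exp x := by
    rw [AddCircle.toCircle_apply_mk, div_self Real.two_pi_pos.ne', one_mul]
  have hfour (n : ℤ) (x : ℝ) :
      fourier n (x : AddCircle (2 * Real.pi)) = (Circle.exp x : ℂ) ^ n := by
    rw [fourier_apply, AddCircle.toCircle_zsmul, hexp, Circle.coe_zpow]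
  let g : C(AddCircle (2 * Real.pi), ℂ) := ⟨fun x => f (r * AddCircle.toCircle x),
    hf.comp_continuous (continuous_const.mul
      (continuous_subtype_val.comp AddCircle.continuous_toCircle))
      fun x => mem_ball_of_abs_lt hr _⟩
  have hg (n : ℤ) : fourierCoeff g n = (2 * Real.pi : ℂ)⁻¹ * circleMode f n r := by
    rw [fourierCoeff_eq_intervalIntegral g n 0, zero_add, circleMode, Complex.real_smul]
    congr 1
    · push_cast; rw [one_div]
    · refine intervalIntegral.integral_congr fun x _ => ?_
      simp only [hfour, smul_eq_mul, g, ContinuousMap.coe_mk, hexp]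
      ring
  have h1 := has_pointwise_sum_fourier_series_of_summable (f := g)
    (by simp only [funext hg]; exact hs.mul_left _) (θ : AddCircle (2 * Real.pi))
  have h2 := h1.mul_left (2 * Real.pi : ℂ)
  have h3 : g (θ : AddCircle (2 * Real.pi)) = f (r * Circle.exp θ) := by
    simp only [g, ContinuousMap.coe_mk, hexp]
  rw [h3] at h2
  refine h2.congr_fun fun n => ?_
  rw [hg, hfour, smul_eq_mul]
  field_simp

/-- Termwise integration of the Fourier expansion of the Poisson kernel. -/
theorem hasSum_integral_poissonKernel {α : ℝ} {f : ℂ → ℂ}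
    (hfc : ContinuousOn f (Metric.ball 0 1)) (hf : ∀ z ∈ Metric.ball (0 : ℂ) 1, ‖f z‖ ≤ 1)
    (hα : -1 < α) {r ρ : ℝ} (hr : r ∈ Set.Ioo (0 : ℝ) 1) (hρ : |ρ| < 1) (t : ℝ) :
    HasSum (fun n : ℤ => (radialCoeff α n r : ℂ) * circleMode f n ρ * (Circle.exp t : ℂ) ^ n)
      (∫ θ in (0 : ℝ)..(2 * Real.pi),
        f (ρ * Circle.exp θ) * poissonKernel α (r * Circle.exp (t - θ))) := by
  have hmain := intervalIntegral.hasSum_integral_of_dominated_convergence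
    (μ := volume) (a := 0) (b := 2 * Real.pi)
    (F := fun (n : ℤ) (θ : ℝ) => f (ρ * Circle.exp θ) *
      ((radialCoeff α n r : ℂ) * (Circle.exp (t - θ) : ℂ) ^ n))
    (f := fun θ => f (ρ * Circle.exp θ) * poissonKernel α (r * Circle.exp (t - θ)))
    (fun n _ => radialCoeff α n r) ?_ ?_ ?_ intervalIntegrable_const ?_
  · refine hmain.congr_fun fun n => ?_
    rw [circleMode, ← intervalIntegral.integral_const_mul, ← intervalIntegral.integral_mul_const]
    refine intervalIntegral.integral_congr fun θ _ => ?_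
    have : (Circle.exp (t - θ) : ℂ) ^ n = (Circle.exp t : ℂ) ^ n * (Circle.exp θ : ℂ) ^ (-n) := by
      rw [Circle.exp_sub, Circle.coe_div, div_zpow, zpow_neg, div_eq_mul_inv]
    rw [this]
    ring
  · intro n
    refine Continuous.aestronglyMeasurable ?_
    exact (continuous_comp_circle hfc hρ).mul (continuous_const.mul
      ((continuous_circleExp_zpow n).comp (continuous_const.sub continuous_id)))
  · intro n
    refine ae_of_all _ fun θ _ => ?_
    rw [norm_mul, norm_mul, norm_zpow, Circle.norm_coe, one_zpow, mul_one, Complex.norm_real,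
      Real.norm_of_nonneg (radialCoeff_nonneg hα hr.1.le hr.2 n)]
    exact mul_le_of_le_one_left (radialCoeff_nonneg hα hr.1.le hr.2 n)
      (hf _ (mem_ball_of_abs_lt hρ _))
  · exact ae_of_all _ fun θ _ => summable_radialCoeff hr.1.le hr.2
  · exact ae_of_all _ fun θ _ =>
      (hasSum_radialCoeff hr.1.le hr.2 (Circle.exp (t - θ))).mul_left _

/-- The Schwarz type estimate: `f(z) - A f(0)` is the limit, as `ρ → 1`, of the integrals of
`f(ρ e^{iθ})` against the Poisson kernel minus the constant `A`. -/
theorem norm_sub_mul_le_integral {α : ℝ} (hα : -1 < α) {f : ℂ → ℂ} (hf : IsAlphaHarmonic α f)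
    (hbd : ∀ z ∈ Metric.ball (0 : ℂ) 1, ‖f z‖ ≤ 1) (A : ℂ) {r : ℝ} (hr : r ∈ Set.Ioo (0 : ℝ) 1)
    (t : ℝ) :
    2 * Real.pi * ‖f (r * Circle.exp t) - A * f 0‖ ≤
      ∫ θ in (0 : ℝ)..(2 * Real.pi), ‖poissonKernel α (r * Circle.exp θ) - A‖ := by
  have hf1 : ContDiffOn ℝ 1 f (Metric.ball 0 1) := hf.1.of_le (by norm_num)
  have hfc := hf1.continuousOn
  have hr' := abs_lt_one_of_mem_Ioo hr
  choose C hC using hf.exists_circleMode_eq hα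
  have hev : ∀ᶠ ρ : ℝ in 𝓝[<] 1, ρ ∈ Set.Ioo (0 : ℝ) 1 := Ioo_mem_nhdsLT (by norm_num)
  have hlim (n : ℤ) : Tendsto (circleMode f n) (𝓝[<] 1) (𝓝 (C n)) := by
    have h1 := ((Complex.continuous_ofReal.tendsto 1).comp (tendsto_radialCoeff hα n)).mul_const
      (C n)
    rw [Complex.ofReal_one, one_mul] at h1
    refine h1.congr' ?_
    filter_upwards [hev] with ρ hρ
    exact (hC n ρ hρ).symm
  -- As `A_0 = 1`, the mean of `f` over a circle does not depend on its radius, so it is `f 0`.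
  have hmean : ∀ ρ ∈ Set.Ioo (0 : ℝ) 1, circleMode f 0 ρ = 2 * Real.pi * f 0 := by
    have h0 : ∀ ρ ∈ Set.Ioo (0 : ℝ) 1, circleMode f 0 ρ = C 0 := by
      intro ρ hρ
      have := radialCoeff_natCast (α := α) hρ.1.le hρ.2 0
      rw [Nat.cast_zero, pow_zero] at this
      rw [hC 0 ρ hρ, this, Complex.ofReal_one, one_mul]
    have h1 : C 0 = circleMode f 0 0 := by
      refine tendsto_nhds_unique (f := circleMode f 0) (l := 𝓝[>] (0 : ℝ)) ?_
        (tendsto_circleMode_zero hf1 0)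
      refine tendsto_const_nhds.congr' ?_
      filter_upwards [Ioo_mem_nhdsGT (zero_lt_one' ℝ)] with x hx
      exact (h0 x hx).symm
    intro ρ hρ
    rw [h0 ρ hρ, h1, circleMode_zero_zero]
  have hnorm : ∀ n : ℤ, ∀ ρ : ℝ, |ρ| < 1 →
      ‖(radialCoeff α n r : ℂ) * circleMode f n ρ * (Circle.exp t : ℂ) ^ n‖ ≤
        radialCoeff α n r * (2 * Real.pi) := by
    intro n ρ hρ
    rw [norm_mul, norm_mul, norm_zpow, Circle.norm_coe, one_zpow, mul_one, Complex.norm_real,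
      Real.norm_of_nonneg (radialCoeff_nonneg hα hr.1.le hr.2 n)]
    exact mul_le_mul_of_nonneg_left (norm_circleMode_le hbd n hρ)
      (radialCoeff_nonneg hα hr.1.le hr.2 n)
  have hsum := (summable_radialCoeff (α := α) hr.1.le hr.2).mul_right (2 * Real.pi)
  have htan : Tendsto (fun ρ : ℝ => ∑' n : ℤ,
      (radialCoeff α n r : ℂ) * circleMode f n ρ * (Circle.exp t : ℂ) ^ n) (𝓝[<] 1)
      (𝓝 (∑' n : ℤ, (radialCoeff α n r : ℂ) * C n * (Circle.exp t : ℂ) ^ n)) := by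
    refine tendsto_tsum_of_dominated_convergence hsum
      (fun n => ((hlim n).const_mul _).mul_const _) ?_
    filter_upwards [hev] with ρ hρ n
    exact hnorm n ρ (abs_lt_one_of_mem_Ioo hρ)
  have hCle (n : ℤ) : ‖C n‖ ≤ 2 * Real.pi := by
    refine le_of_tendsto (hlim n).norm ?_
    filter_upwards [hev] with ρ hρ
    exact norm_circleMode_le hbd n (abs_lt_one_of_mem_Ioo hρ)
  have hser : ∑' n : ℤ, (radialCoeff α n r : ℂ) * C n * (Circle.exp t : ℂ) ^ n =
      2 * Real.pi * f (r * Circle.exp t) := by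
    have hs : Summable fun n : ℤ => circleMode f n r := by
      refine Summable.of_norm_bounded hsum fun n => ?_
      rw [hC n r hr, norm_mul, Complex.norm_real,
        Real.norm_of_nonneg (radialCoeff_nonneg hα hr.1.le hr.2 n)]
      exact mul_le_mul_of_nonneg_left (hCle n) (radialCoeff_nonneg hα hr.1.le hr.2 n)
    rw [← (hasSum_circleMode hfc hr' hs t).tsum_eq]
    exact tsum_congr fun n => by rw [hC n r hr]
  rw [hser] at htan
  have hK : Continuous fun θ : ℝ => poissonKernel α (r * Circle.exp (t - θ)) :=
    (continuous_comp_circle (continuousOn_poissonKernel α) hr').comp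
      (continuous_const.sub continuous_id)
  have hshift : ∫ θ in (0 : ℝ)..(2 * Real.pi), ‖poissonKernel α (r * Circle.exp (t - θ)) - A‖ =
      ∫ θ in (0 : ℝ)..(2 * Real.pi), ‖poissonKernel α (r * Circle.exp θ) - A‖ := by
    have hper : Function.Periodic (fun θ : ℝ => ‖poissonKernel α (r * Circle.exp θ) - A‖)
        (2 * Real.pi) := fun θ => by
      simp only [Circle.periodic_exp θ]
    rw [intervalIntegral.integral_comp_sub_left
      (fun θ : ℝ => ‖poissonKernel α (r * Circle.exp θ) - A‖) t, sub_zero]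
    have := hper.intervalIntegral_add_eq (t - 2 * Real.pi) 0
    rwa [sub_add_cancel, zero_add] at this
  -- The estimate holds for the average over each circle of radius `ρ`; it survives in the limit.
  have hfin : Tendsto (fun ρ : ℝ => ‖(∑' n : ℤ,
      (radialCoeff α n r : ℂ) * circleMode f n ρ * (Circle.exp t : ℂ) ^ n) -
        2 * Real.pi * (A * f 0)‖) (𝓝[<] 1)
      (𝓝 ‖2 * Real.pi * f (r * Circle.exp t) - 2 * Real.pi * (A * f 0)‖) :=
    (htan.sub_const _).norm
  have hleft : ‖2 * Real.pi * f (r * Circle.exp t) - 2 * Real.pi * (A * f 0)‖ =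
      2 * Real.pi * ‖f (r * Circle.exp t) - A * f 0‖ := by
    rw [← mul_sub, norm_mul]
    congr 1
    simp [abs_of_pos Real.pi_pos]
  rw [← hleft, ← hshift]
  refine le_of_tendsto hfin ?_
  filter_upwards [hev] with ρ hρ
  have hρ' := abs_lt_one_of_mem_Ioo hρ
  have hfρ := continuous_comp_circle hfc hρ'
  have h0 : 2 * Real.pi * (A * f 0) =
      ∫ θ in (0 : ℝ)..(2 * Real.pi), f (ρ * Circle.exp θ) * A := by
    rw [intervalIntegral.integral_mul_const]
    have := hmean ρ hρ
    simp only [circleMode, neg_zero, zpow_zero, mul_one] at this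
    rw [this]
    ring
  have i1 : IntervalIntegrable (fun θ : ℝ => f (ρ * Circle.exp θ) *
      poissonKernel α (r * Circle.exp (t - θ))) volume 0 (2 * Real.pi) :=
    (hfρ.mul hK).intervalIntegrable _ _
  have i2 : IntervalIntegrable (fun θ : ℝ => f (ρ * Circle.exp θ) * A) volume 0 (2 * Real.pi) :=
    (hfρ.mul continuous_const).intervalIntegrable _ _
  rw [(hasSum_integral_poissonKernel hfc hbd hα hr hρ' t).tsum_eq, h0,
    ← intervalIntegral.integral_sub i1 i2]
  refine intervalIntegral.norm_integral_le_of_norm_le Real.two_pi_pos.le ?_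
    (((hK.sub continuous_const).norm).intervalIntegrable _ _)
  refine ae_of_all _ fun θ _ => ?_
  rw [← mul_sub, norm_mul]
  exact mul_le_of_le_one_left (norm_nonneg _) (hbd _ (mem_ball_of_abs_lt hρ' _))

/-! ### The hypergeometric integral -/

theorem ordinaryHypergeometricCoefficient_half (b : ℝ) (n : ℕ) :
    ordinaryHypergeometricCoefficient (1 / 2 : ℝ) b (3 / 2) n =
      Ring.multichoose b n / (2 * n + 1) := by
  have h : ∀ n : ℕ, (ascPochhammer ℝ n).eval (3 / 2 : ℝ) =
      (2 * n + 1) * (ascPochhammer ℝ n).eval (1 / 2 : ℝ) := by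
    intro n
    induction n with
    | zero => simp
    | succ n ih =>
      rw [ascPochhammer_succ_eval, ascPochhammer_succ_eval, ih]
      push_cast
      ring
  have hpos := ascPochhammer_pos (S := ℝ) n (1 / 2) (by norm_num)
  rw [ordinaryHypergeometricCoefficient, multichoose_eq_ascPochhammer_div, h]
  have : (n.factorial : ℝ) ≠ 0 := by positivity
  field_simp

theorem mul_sq_lt_one {x t : ℝ} (hx0 : 0 ≤ x) (hx1 : x < 1) (ht : |t| ≤ 1) : x * t ^ 2 < 1 := by
  have := (sq_le_one_iff_abs_le_one t).2 ht
  nlinarith [sq_nonneg t]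

/-- Euler's integral for `₂F₁(1/2, b; 3/2; x)` after the substitution of `t²`: termwise integration
of the binomial series. -/
theorem ordinaryHypergeometric_half_eq_integral (b : ℝ) {x : ℝ} (hx0 : 0 ≤ x) (hx1 : x < 1) :
    ordinaryHypergeometric (1 / 2 : ℝ) b (3 / 2) x = ∫ t in (0 : ℝ)..1, (1 - x * t ^ 2) ^ (-b) := by
  have hxabs : |x| < 1 := by rwa [abs_of_nonneg hx0]
  have hmain := intervalIntegral.hasSum_integral_of_dominated_convergence
    (μ := volume) (a := 0) (b := 1)
    (F := fun (n : ℕ) (t : ℝ) => Ring.multichoose b n * (x * t ^ 2) ^ n)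
    (f := fun t => (1 - x * t ^ 2) ^ (-b))
    (fun n _ => ‖Ring.multichoose b n * x ^ n‖)
    (fun n => Continuous.aestronglyMeasurable (by fun_prop)) ?_ ?_ intervalIntegrable_const ?_
  · rw [ordinaryHypergeometric_eq_tsum, ← hmain.tsum_eq]
    refine tsum_congr fun n => ?_
    have h1 := ordinaryHypergeometricCoefficient_half b n
    rw [ordinaryHypergeometricCoefficient] at h1
    rw [h1, smul_eq_mul]
    have h2 : (fun t : ℝ => Ring.multichoose b n * (x * t ^ 2) ^ n) =
        fun t => (Ring.multichoose b n * x ^ n) * t ^ (2 * n) := by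
      funext t; rw [mul_pow, pow_mul]; ring
    rw [h2, intervalIntegral.integral_const_mul, integral_pow]
    push_cast
    simp
    ring
  · intro n
    refine ae_of_all _ fun t ht => ?_
    rw [Set.uIoc_of_le zero_le_one] at ht
    rw [norm_mul, norm_mul, norm_pow, norm_pow, norm_mul, norm_pow]
    gcongr
    refine mul_le_of_le_one_right (norm_nonneg _) (pow_le_one₀ (norm_nonneg _) ?_)
    rw [Real.norm_of_nonneg ht.1.le]
    exact ht.2
  · exact ae_of_all _ fun t _ => (hasSum_one_sub_rpow_neg b hxabs).summable.norm
  · refine ae_of_all _ fun t ht => ?_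
    rw [Set.uIoc_of_le zero_le_one] at ht
    refine hasSum_one_sub_rpow_neg b ?_
    rw [abs_of_nonneg (by positivity)]
    exact mul_sq_lt_one hx0 hx1 (by rw [abs_of_nonneg ht.1.le]; exact ht.2)

/-! ### Trigonometric integrals -/

/-- The maximum of `(1 + x)^p + (1 - x)^p` over `|x| ≤ 1`, where `p = 1 + α / 2`. -/
noncomputable def foldConst (α : ℝ) : ℝ := if 0 ≤ α then (2 : ℝ) ^ (1 + α / 2) else 2

theorem one_add_rpow_add_one_sub_rpow_le {α : ℝ} (hα : -1 < α) {x : ℝ} (hx : |x| ≤ 1) :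
    (1 + x) ^ (1 + α / 2) + (1 - x) ^ (1 + α / 2) ≤ foldConst α := by
  have h1 : 0 ≤ 1 + x := by linarith [(abs_le.1 hx).1]
  have h2 : 0 ≤ 1 - x := by linarith [(abs_le.1 hx).2]
  unfold foldConst
  split_ifs with h
  · have := Real.add_rpow_le_rpow_add h1 h2 (p := 1 + α / 2) (by linarith)
    convert this using 2
    ring
  · have := (Real.concaveOn_rpow (p := 1 + α / 2) (by linarith) (by linarith)).2
      (Set.mem_Ici.2 h1) (Set.mem_Ici.2 h2) (by norm_num : (0 : ℝ) ≤ 1 / 2)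
      (by norm_num : (0 : ℝ) ≤ 1 / 2) (by norm_num)
    simp only [smul_eq_mul] at this
    have h3 : 1 / 2 * (1 + x) + 1 / 2 * (1 - x) = 1 := by ring
    rw [h3, Real.one_rpow] at this
    linarith

theorem one_sub_rpow_neg_add_one_add_rpow_neg_le {α : ℝ} (hα : -1 < α) {x : ℝ} (hx : |x| < 1) :
    (1 - x) ^ (-(1 + α / 2)) + (1 + x) ^ (-(1 + α / 2)) ≤
      foldConst α * (1 - x ^ 2) ^ (-(1 + α / 2)) := by
  have h1 : 0 < 1 + x := by linarith [(abs_lt.1 hx).1]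
  have h2 : 0 < 1 - x := by linarith [(abs_lt.1 hx).2]
  have h3 : 1 - x ^ 2 = (1 - x) * (1 + x) := by ring
  have p1 := Real.rpow_pos_of_pos h1 (1 + α / 2)
  have p2 := Real.rpow_pos_of_pos h2 (1 + α / 2)
  rw [h3, Real.mul_rpow h2.le h1.le, Real.rpow_neg h1.le, Real.rpow_neg h2.le]
  have h4 := mul_le_mul_of_nonneg_right (one_add_rpow_add_one_sub_rpow_le hα hx.le)
    (by positivity : 0 ≤ ((1 - x) ^ (1 + α / 2))⁻¹ * ((1 + x) ^ (1 + α / 2))⁻¹)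
  refine le_trans (le_of_eq ?_) h4
  field_simp

theorem abs_mul_cos_lt_one {k : ℝ} (hk0 : 0 ≤ k) (hk1 : k < 1) (θ : ℝ) : |k * Real.cos θ| < 1 := by
  rw [abs_mul, abs_of_nonneg hk0]
  have := Real.abs_cos_le_one θ
  nlinarith [abs_nonneg (Real.cos θ)]

theorem continuous_abs_cos_mul_rpow {k : ℝ} (hk0 : 0 ≤ k) (hk1 : k < 1) (p : ℝ) :
    Continuous fun θ : ℝ => |Real.cos θ| * (1 - k * Real.cos θ) ^ p := by
  refine (Real.continuous_cos.abs).mul (Continuous.rpow_const (by fun_prop) fun θ => Or.inl ?_)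
  linarith [(abs_lt.1 (abs_mul_cos_lt_one hk0 hk1 θ)).2]

theorem one_sub_sq_mul_cos_sq_pos {k : ℝ} (hk0 : 0 ≤ k) (hk1 : k < 1) (θ : ℝ) :
    0 < 1 - k ^ 2 * Real.cos θ ^ 2 := by
  have := (sq_lt_one_iff_abs_lt_one _).2 (abs_mul_cos_lt_one hk0 hk1 θ)
  rw [mul_pow] at this
  linarith

theorem continuous_one_sub_sq_mul_cos_sq_rpow {k : ℝ} (hk0 : 0 ≤ k) (hk1 : k < 1) (p : ℝ) :
    Continuous fun θ : ℝ => (1 - k ^ 2 * Real.cos θ ^ 2) ^ p :=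
  Continuous.rpow_const (by fun_prop) fun θ => Or.inl (one_sub_sq_mul_cos_sq_pos hk0 hk1 θ).ne'

/-- The half circles `cos ≥ 0` and `cos ≤ 0` are superposed by `θ ↦ θ + π`. -/
theorem integral_abs_cos_mul_rpow_le {α : ℝ} (hα : -1 < α) {k : ℝ} (hk0 : 0 ≤ k) (hk1 : k < 1) :
    ∫ θ in (0 : ℝ)..(2 * Real.pi), |Real.cos θ| * (1 - k * Real.cos θ) ^ (-(1 + α / 2)) ≤
      foldConst α * ∫ θ in (-(Real.pi / 2))..(Real.pi / 2),
        Real.cos θ * (1 - k ^ 2 * Real.cos θ ^ 2) ^ (-(1 + α / 2)) := by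
  set G : ℝ → ℝ := fun θ => |Real.cos θ| * (1 - k * Real.cos θ) ^ (-(1 + α / 2)) with hG
  have hGc : Continuous G := continuous_abs_cos_mul_rpow hk0 hk1 _
  have hGi : ∀ a b : ℝ, IntervalIntegrable G volume a b := fun a b => hGc.intervalIntegrable a b
  have hGi' : ∀ a b : ℝ, IntervalIntegrable (fun θ => G (θ + Real.pi)) volume a b := fun a b =>
    (hGc.comp (continuous_id.add continuous_const)).intervalIntegrable a b
  have hper : Function.Periodic G (2 * Real.pi) := fun θ => by simp only [hG, Real.cos_add_two_pi]
  have h1 : ∫ θ in (0 : ℝ)..(2 * Real.pi), G θ =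
      ∫ θ in (-(Real.pi / 2))..(Real.pi / 2), (G θ + G (θ + Real.pi)) := by
    have e1 := hper.intervalIntegral_add_eq 0 (-(Real.pi / 2))
    rw [zero_add] at e1
    rw [e1, ← intervalIntegral.integral_add_adjacent_intervals (hGi _ (Real.pi / 2)) (hGi _ _),
      intervalIntegral.integral_add (hGi _ _) (hGi' _ _),
      intervalIntegral.integral_comp_add_right]
    congr 2 <;> ring
  rw [h1, ← intervalIntegral.integral_const_mul]
  refine intervalIntegral.integral_mono_on (by linarith [Real.pi_pos]) ?_ ?_ fun θ hθ => ?_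
  · exact (hGi _ _).add (hGi' _ _)
  · exact (continuous_const.mul (Real.continuous_cos.mul
      (continuous_one_sub_sq_mul_cos_sq_rpow hk0 hk1 _))).intervalIntegrable _ _
  · have hcos := Real.cos_nonneg_of_mem_Icc hθ
    have h2 := mul_le_mul_of_nonneg_left
      (one_sub_rpow_neg_add_one_add_rpow_neg_le hα (abs_mul_cos_lt_one hk0 hk1 θ)) hcos
    simp only [hG, Real.cos_add_pi, abs_neg, abs_of_nonneg hcos]
    rw [mul_neg, sub_neg_eq_add, ← mul_pow]
    linarith

/-- The substitution `t = sin θ / √(1 - k² cos² θ)`. -/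
theorem integral_cos_mul_rpow_eq (α : ℝ) {k : ℝ} (hk0 : 0 ≤ k) (hk1 : k < 1) :
    ∫ θ in (-(Real.pi / 2))..(Real.pi / 2),
        Real.cos θ * (1 - k ^ 2 * Real.cos θ ^ 2) ^ (-(1 + α / 2)) =
      2 * (1 - k ^ 2) ^ (-((1 + α) / 2)) *
        ∫ t in (0 : ℝ)..1, (1 - k ^ 2 * t ^ 2) ^ (-(1 / 2 - α / 2)) := by
  have hk2 : k ^ 2 < 1 := by nlinarith
  have hc : 0 < 1 - k ^ 2 := by linarith
  set D : ℝ → ℝ := fun θ => 1 - k ^ 2 * Real.cos θ ^ 2 with hD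
  have hDpos : ∀ θ, 0 < D θ := one_sub_sq_mul_cos_sq_pos hk0 hk1
  have hDd : ∀ θ, HasDerivAt D (2 * k ^ 2 * Real.cos θ * Real.sin θ) θ := fun θ => by
    have := (((Real.hasDerivAt_cos θ).pow 2).const_mul (k ^ 2)).const_sub 1
    refine this.congr_deriv ?_
    simp
    ring
  have hsub : ∀ θ, D θ - k ^ 2 * Real.sin θ ^ 2 = 1 - k ^ 2 := fun θ => by
    simp only [hD]; linear_combination (-k ^ 2) * Real.sin_sq_add_cos_sq θ
  set T : ℝ → ℝ := fun θ => Real.sin θ * D θ ^ (-(1 / 2) : ℝ) with hT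
  have hTd : ∀ θ, HasDerivAt T (Real.cos θ * ((1 - k ^ 2) * D θ ^ (-(3 / 2) : ℝ))) θ := fun θ => by
    have h1 := (Real.hasDerivAt_sin θ).mul
      ((hDd θ).rpow_const (p := -(1 / 2)) (Or.inl (hDpos θ).ne'))
    refine h1.congr_deriv ?_
    have h2 : D θ ^ (-(1 / 2) : ℝ) = D θ ^ (-(3 / 2) : ℝ) * D θ := by
      rw [← Real.rpow_add_one (hDpos θ).ne']; norm_num
    have h3 : (-(1 / 2) - 1 : ℝ) = -(3 / 2) := by norm_num
    rw [h3, h2, ← hsub θ]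
    ring
  have hTsq : ∀ θ, 1 - k ^ 2 * T θ ^ 2 = (1 - k ^ 2) * (D θ)⁻¹ := fun θ => by
    have h1 : (D θ ^ (-(1 / 2) : ℝ)) ^ 2 = (D θ)⁻¹ := by
      rw [← Real.rpow_natCast, ← Real.rpow_mul (hDpos θ).le, ← Real.rpow_neg_one]
      norm_num
    rw [← hsub θ]
    simp only [hT, mul_pow, h1]
    have := (hDpos θ).ne'
    field_simp
  have hT1 : T (Real.pi / 2) = 1 := by simp [hT, hD]
  have hT2 : T (-(Real.pi / 2)) = -1 := by simp [hT, hD]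
  set g : ℝ → ℝ := fun t => (1 - k ^ 2 * t ^ 2) ^ (-(1 / 2 - α / 2)) with hg
  have hpos : ∀ t : ℝ, |t| ≤ 1 → 0 < 1 - k ^ 2 * t ^ 2 := fun t ht => by
    linarith [mul_sq_lt_one (sq_nonneg k) hk2 ht]
  have hgc : ContinuousOn g (Set.Icc (-1) 1) := fun t ht => by
    refine ContinuousAt.continuousWithinAt (ContinuousAt.rpow_const (by fun_prop) (Or.inl ?_))
    exact (hpos t (abs_le.2 ht)).ne'
  have himage : T '' Set.uIcc (-(Real.pi / 2)) (Real.pi / 2) ⊆ {t | 0 < 1 - k ^ 2 * t ^ 2} := by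
    rintro _ ⟨θ, _, rfl⟩
    change 0 < 1 - k ^ 2 * T θ ^ 2
    rw [hTsq]
    exact mul_pos hc (inv_pos.2 (hDpos θ))
  have hcov := intervalIntegral.integral_comp_mul_deriv' (a := -(Real.pi / 2)) (b := Real.pi / 2)
    (f := T) (g := g) (fun θ _ => hTd θ)
    (Continuous.continuousOn (Real.continuous_cos.mul (continuous_const.mul
      (continuous_one_sub_sq_mul_cos_sq_rpow hk0 hk1 _)))) fun t ht =>
        ContinuousAt.continuousWithinAt (ContinuousAt.rpow_const (by fun_prop)
          (Or.inl (ne_of_gt (himage ht))))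
  rw [hT1, hT2] at hcov
  have hint : ∀ θ, (g ∘ T) θ * (Real.cos θ * ((1 - k ^ 2) * D θ ^ (-(3 / 2) : ℝ))) =
      (1 - k ^ 2) ^ ((1 + α) / 2) * (Real.cos θ * D θ ^ (-(1 + α / 2))) := fun θ => by
    have hDp := hDpos θ
    simp only [Function.comp, hg]
    rw [hTsq, Real.mul_rpow hc.le (inv_pos.2 hDp).le, Real.inv_rpow hDp.le, ← Real.rpow_neg hDp.le]
    have h1 : (1 - k ^ 2) ^ ((1 + α) / 2) = (1 - k ^ 2) ^ (-(1 / 2 - α / 2)) * (1 - k ^ 2) := by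
      rw [← Real.rpow_add_one hc.ne']; congr 1; ring
    have h2 : D θ ^ (-(1 + α / 2)) = D θ ^ (-(-(1 / 2 - α / 2))) * D θ ^ (-(3 / 2) : ℝ) := by
      rw [← Real.rpow_add hDp]; congr 1; ring
    rw [h1, h2]
    ring
  rw [funext hint, intervalIntegral.integral_const_mul] at hcov
  have heven : ∫ t in (-1 : ℝ)..1, g t = 2 * ∫ t in (0 : ℝ)..1, g t := by
    have i1 : IntervalIntegrable g volume (-1) 0 := by
      refine ContinuousOn.intervalIntegrable (hgc.mono ?_)
      rw [Set.uIcc_of_le (by norm_num)]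
      exact Set.Icc_subset_Icc le_rfl zero_le_one
    have i2 : IntervalIntegrable g volume 0 1 := by
      refine ContinuousOn.intervalIntegrable (hgc.mono ?_)
      rw [Set.uIcc_of_le (by norm_num)]
      exact Set.Icc_subset_Icc (by norm_num) le_rfl
    rw [← intervalIntegral.integral_add_adjacent_intervals i1 i2]
    have h1 := intervalIntegral.integral_comp_neg (a := 0) (b := 1) g
    have h2 : ∀ t, g (-t) = g t := fun t => by simp [hg]
    rw [neg_zero, funext h2] at h1
    rw [← h1]
    ring
  rw [heven] at hcov
  rw [Real.rpow_neg hc.le]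
  have hcp := (Real.rpow_pos_of_pos hc ((1 + α) / 2)).ne'
  rw [mul_right_comm, ← hcov, mul_right_comm, mul_inv_cancel₀ hcp, one_mul]

/-! ### The explicit bound -/

theorem one_sub_mul_one_sub_conj {r θ : ℝ} :
    (1 - r * (Circle.exp θ : ℂ)) * (1 - (starRingEnd ℂ) (r * (Circle.exp θ : ℂ))) =
      ((1 + r ^ 2 - 2 * r * Real.cos θ : ℝ) : ℂ) := by
  have h1 : (Circle.exp θ : ℂ) = Real.cos θ + Real.sin θ * Complex.I := by
    rw [Circle.coe_exp, Complex.exp_mul_I, Complex.ofReal_cos, Complex.ofReal_sin]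
  have h2 : (Real.sin θ : ℂ) ^ 2 + (Real.cos θ : ℂ) ^ 2 = 1 := by
    exact_mod_cast Real.sin_sq_add_cos_sq θ
  rw [h1]
  simp only [map_mul, map_add, Complex.conj_ofReal, Complex.conj_I]
  push_cast at h2 ⊢
  linear_combination (r : ℂ) ^ 2 * h2 - (r : ℂ) ^ 2 * (Complex.sin θ) ^ 2 * Complex.I_sq

/-- With `N = |1 - w|²` and `E = (1 - w̄)^(-α)`, the Poisson kernel is `(1 - |w|²)^(α+1) E / N`, and
`E / N - 1 / (1 + r²) = (E · 2 Re w / N + (E - 1)) / (1 + r²)`. -/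
theorem norm_poissonKernel_sub_le {α : ℝ} (hα : -1 < α) {r : ℝ} (hr : r ∈ Set.Ioo (0 : ℝ) 1)
    (θ : ℝ) :
    ‖poissonKernel α (r * Circle.exp θ) - (((1 - r ^ 2) ^ (α + 1) / (1 + r ^ 2) : ℝ) : ℂ)‖ ≤
      (1 - r ^ 2) ^ (α + 1) / (1 + r ^ 2) * (|(1 - r) ^ (-α) - 1| +
        2 * r * (|Real.cos θ| * (1 + r ^ 2 - 2 * r * Real.cos θ) ^ (-(1 + α / 2)))) := by
  obtain ⟨hr0, hr1⟩ := hr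
  set w : ℂ := r * Circle.exp θ with hw
  have hnw : ‖w‖ = r := by simp [hw, abs_of_pos hr0]
  set v : ℂ := 1 - (starRingEnd ℂ) w with hv
  have hcw : ‖(starRingEnd ℂ) w‖ = r := by rw [RCLike.norm_conj, hnw]
  have hv0 : v ≠ 0 := one_sub_ne_zero (by rw [hcw]; exact hr1)
  have hw0 : 1 - w ≠ 0 := one_sub_ne_zero (by rw [hnw]; exact hr1)
  set N : ℝ := 1 + r ^ 2 - 2 * r * Real.cos θ with hN
  have hNeq : (1 - w) * v = (N : ℂ) := one_sub_mul_one_sub_conj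
  have hNC : (N : ℂ) ≠ 0 := by rw [← hNeq]; exact mul_ne_zero hw0 hv0
  have hNpos : 0 < N := by
    have := Real.cos_le_one θ
    rw [hN]
    nlinarith [sq_pos_of_pos (sub_pos.2 hr1)]
  have hnv : ‖v‖ ^ 2 = N := by
    have h1 : ‖1 - w‖ = ‖v‖ := by
      rw [← RCLike.norm_conj, hv, map_sub, map_one]
    have h2 := congrArg norm hNeq
    rw [norm_mul, h1, Complex.norm_real, Real.norm_of_nonneg hNpos.le] at h2
    rw [sq, h2]
  set E : ℂ := v ^ (-(α : ℂ)) with hE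
  have hEn : ‖E‖ = N ^ (-α / 2) := by
    have h1 : ‖E‖ = ‖v‖ ^ (-α) := by
      rw [hE, ← Complex.ofReal_neg, Complex.norm_cpow_real]
    rw [h1, ← hnv, ← Real.rpow_natCast, ← Real.rpow_mul (norm_nonneg v)]
    congr 1
    push_cast
    ring
  have hE1 : ‖E - 1‖ ≤ |(1 - r) ^ (-α) - 1| := by
    have := norm_one_sub_cpow_neg_sub_one_le hα (w := (starRingEnd ℂ) w) (by rw [hcw]; exact hr1)
    rwa [hcw] at this
  have hsplit : v ^ (-((α + 1 : ℝ) : ℂ)) = E * v⁻¹ := by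
    rw [hE, ← Complex.cpow_neg_one, ← Complex.cpow_add _ _ hv0]
    congr 1
    push_cast
    ring
  have hs : 0 ≤ (1 - r ^ 2) ^ (α + 1) / (1 + r ^ 2) :=
    div_nonneg (Real.rpow_nonneg (by nlinarith) _) (by positivity)
  have hr2 : ((1 + r ^ 2 : ℝ) : ℂ) ≠ 0 := by
    exact_mod_cast (by positivity : (1 + r ^ 2 : ℝ) ≠ 0)
  have hK : poissonKernel α w - (((1 - r ^ 2) ^ (α + 1) / (1 + r ^ 2) : ℝ) : ℂ) =
      (((1 - r ^ 2) ^ (α + 1) / (1 + r ^ 2) : ℝ) : ℂ) *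
        ((E - 1) + E * ((2 * r * Real.cos θ : ℝ) : ℂ) * (N : ℂ)⁻¹) := by
    have h1 : (1 - w)⁻¹ * (E * v⁻¹) = E * (N : ℂ)⁻¹ := by
      rw [← hNeq, mul_inv]; ring
    have h2 : ((2 * r * Real.cos θ : ℝ) : ℂ) = ((1 + r ^ 2 : ℝ) : ℂ) - N := by
      rw [hN]; push_cast; ring
    rw [poissonKernel, hnw, hsplit, h1, h2, Complex.ofReal_div]
    field_simp
    ring
  rw [hK, norm_mul, Complex.norm_real, Real.norm_of_nonneg hs]
  refine mul_le_mul_of_nonneg_left ((norm_add_le _ _).trans (add_le_add hE1 (le_of_eq ?_))) hs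
  rw [norm_mul, norm_mul, norm_inv, Complex.norm_real, Complex.norm_real, hEn,
    Real.norm_of_nonneg hNpos.le, Real.norm_eq_abs, abs_mul, abs_of_pos (by positivity : 0 < 2 * r)]
  have h3 : N ^ (-(1 + α / 2)) = N ^ (-α / 2) * N⁻¹ := by
    rw [← Real.rpow_neg_one N, ← Real.rpow_add hNpos]
    congr 1
    ring
  rw [h3]
  ring

/-- Combination of the pointwise estimate of the kernel with the trigonometric integrals, for
`k = 2r / (1 + r²)`. -/
theorem integral_norm_poissonKernel_sub_le {α : ℝ} (hα : -1 < α) {r : ℝ}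
    (hr : r ∈ Set.Ioo (0 : ℝ) 1) :
    ∫ θ in (0 : ℝ)..(2 * Real.pi), ‖poissonKernel α (r * Circle.exp θ) -
        (((1 - r ^ 2) ^ (α + 1) / (1 + r ^ 2) : ℝ) : ℂ)‖ ≤
      2 * Real.pi * schwarzBound r α := by
  have hr' := abs_lt_one_of_mem_Ioo hr
  obtain ⟨hr0, hr1⟩ := id hr
  set k : ℝ := 2 * r / (1 + r ^ 2) with hk
  have hR : 0 < 1 + r ^ 2 := by positivity
  have hk0 : 0 ≤ k := by positivity
  have hk1 : k < 1 := by
    rw [hk, div_lt_one hR]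
    nlinarith [sq_pos_of_pos (sub_pos.2 hr1)]
  have hksq : k ^ 2 = 4 * r ^ 2 / (1 + r ^ 2) ^ 2 := by rw [hk, div_pow]; ring
  have hs : 0 < 1 - r ^ 2 := by nlinarith
  have hk2 : 1 - k ^ 2 = ((1 - r ^ 2) / (1 + r ^ 2)) ^ 2 := by
    rw [hksq]; field_simp; ring
  have hN : ∀ θ : ℝ, (1 + r ^ 2 - 2 * r * Real.cos θ) ^ (-(1 + α / 2)) =
      (1 + r ^ 2) ^ (-(1 + α / 2)) * (1 - k * Real.cos θ) ^ (-(1 + α / 2)) := fun θ => by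
    rw [← Real.mul_rpow hR.le (by linarith [(abs_lt.1 (abs_mul_cos_lt_one hk0 hk1 θ)).2])]
    congr 1
    rw [hk]
    field_simp
  have hx1 : k ^ 2 < 1 := by nlinarith
  have hF := ordinaryHypergeometric_half_eq_integral (1 / 2 - α / 2) (sq_nonneg k) hx1
  have hJ := integral_abs_cos_mul_rpow_le hα hk0 hk1
  rw [integral_cos_mul_rpow_eq α hk0 hk1, ← hF] at hJ
  set F : ℝ := ordinaryHypergeometric (1 / 2 : ℝ) (1 / 2 - α / 2) (3 / 2) (k ^ 2) with hFdef
  set J : ℝ := ∫ θ in (0 : ℝ)..(2 * Real.pi),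
    |Real.cos θ| * (1 - k * Real.cos θ) ^ (-(1 + α / 2)) with hJdef
  have hGc := continuous_abs_cos_mul_rpow hk0 hk1 (-(1 + α / 2))
  set S : ℝ := (1 - r ^ 2) ^ (α + 1) / (1 + r ^ 2) with hS
  have hS0 : 0 ≤ S := div_nonneg (Real.rpow_nonneg hs.le _) hR.le
  set a : ℝ := |(1 - r) ^ (-α) - 1| with ha
  have hpt : ∀ θ : ℝ, ‖poissonKernel α (r * Circle.exp θ) - (S : ℂ)‖ ≤
      S * a + S * (2 * r * (1 + r ^ 2) ^ (-(1 + α / 2))) *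
        (|Real.cos θ| * (1 - k * Real.cos θ) ^ (-(1 + α / 2))) := fun θ => by
    refine (norm_poissonKernel_sub_le hα hr θ).trans (le_of_eq ?_)
    rw [hN]
    ring
  have hbound : Continuous fun θ : ℝ => S * a + S * (2 * r * (1 + r ^ 2) ^ (-(1 + α / 2))) *
        (|Real.cos θ| * (1 - k * Real.cos θ) ^ (-(1 + α / 2))) :=
    continuous_const.add (continuous_const.mul hGc)
  have hKc : Continuous fun θ : ℝ => ‖poissonKernel α (r * Circle.exp θ) - (S : ℂ)‖ :=
    ((continuous_comp_circle (continuousOn_poissonKernel α) hr').sub continuous_const).norm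
  have h1 := intervalIntegral.integral_mono (μ := volume) Real.two_pi_pos.le
    (hKc.intervalIntegrable _ _) (hbound.intervalIntegrable _ _) hpt
  refine h1.trans ?_
  rw [intervalIntegral.integral_add (continuous_const.intervalIntegrable _ _)
    ((hGc.intervalIntegrable _ _).const_mul _), intervalIntegral.integral_const,
    intervalIntegral.integral_const_mul, ← hJdef, smul_eq_mul, sub_zero]
  have h2 : 0 ≤ S * (2 * r * (1 + r ^ 2) ^ (-(1 + α / 2))) :=
    mul_nonneg hS0 (mul_nonneg (by positivity) (Real.rpow_nonneg hR.le _))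
  refine (add_le_add_right (mul_le_mul_of_nonneg_left hJ h2) _).trans (le_of_eq ?_)
  have hconst : (if 0 ≤ α then (2 : ℝ) ^ (2 + α / 2) else 4) = 2 * foldConst α := by
    unfold foldConst
    split_ifs
    · rw [show 2 + α / 2 = (1 + α / 2) + 1 by ring, Real.rpow_add_one two_ne_zero, mul_comm]
    · norm_num
  have hpow : (1 - k ^ 2) ^ (-((1 + α) / 2)) =
      ((1 - r ^ 2) ^ (α + 1))⁻¹ * (1 + r ^ 2) ^ (α + 1) := by
    rw [hk2, ← Real.rpow_natCast, ← Real.rpow_mul (div_pos hs hR).le,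
      show ((2 : ℕ) : ℝ) * -((1 + α) / 2) = -(α + 1) by push_cast; ring,
      Real.rpow_neg (div_pos hs hR).le, Real.div_rpow hs.le hR.le, inv_div, div_eq_mul_inv, mul_comm]
  have hexp : (1 + r ^ 2) ^ (-(1 + α / 2)) * (1 + r ^ 2) ^ (α + 1) / (1 + r ^ 2) =
      (1 + r ^ 2) ^ (α / 2 - 1) := by
    rw [← Real.rpow_add hR, ← Real.rpow_sub_one hR.ne']
    congr 1
    ring
  rw [schwarzBound, hconst, ← hksq, ← hFdef, ← ha, ← hexp, hpow, hS]
  have := (Real.rpow_pos_of_pos hs (α + 1)).ne'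
  field_simp

/-! ### The bound near the unit circle -/

theorem intervalIntegrable_one_sub_rpow {e : ℝ} (he : -1 < e) :
    IntervalIntegrable (fun t : ℝ => (1 - t) ^ e) volume 0 1 := by
  have := (intervalIntegral.intervalIntegrable_rpow' (a := 0) (b := 1) he).comp_sub_left 1
  simpa using this.symm

theorem rpow_le_one_add_rpow {x y e : ℝ} (hx : 0 < x) (hxy : x ≤ y) (hy : y ≤ 1) :
    y ^ e ≤ 1 + x ^ e := by
  rcases le_total 0 e with he | he
  · have := Real.rpow_le_one (hx.le.trans hxy) hy he
    linarith [Real.rpow_nonneg hx.le e]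
  · have := Real.rpow_le_rpow_of_nonpos hx hxy he
    linarith

theorem tendsto_ordinaryHypergeometric_half {b : ℝ} (hb : b < 1) :
    Tendsto (fun x : ℝ => ordinaryHypergeometric (1 / 2 : ℝ) b (3 / 2) x) (𝓝[<] 1)
      (𝓝 (∫ t in (0 : ℝ)..1, (1 - t ^ 2) ^ (-b))) := by
  have hev : ∀ᶠ x : ℝ in 𝓝[<] 1, x ∈ Set.Ioo (0 : ℝ) 1 := Ioo_mem_nhdsLT (by norm_num)
  have hmain : Tendsto (fun x : ℝ => ∫ t in (0 : ℝ)..1, (1 - x * t ^ 2) ^ (-b)) (𝓝[<] 1)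
      (𝓝 (∫ t in (0 : ℝ)..1, (1 - t ^ 2) ^ (-b))) := by
    have hne : ∀ᵐ t : ℝ, t ≠ 1 := by simp [ae_iff]
    refine intervalIntegral.tendsto_integral_filter_of_dominated_convergence
      (fun t => 1 + (1 - t) ^ (-b)) ?_ ?_
      (intervalIntegrable_const.add (intervalIntegrable_one_sub_rpow (by linarith))) ?_
    · filter_upwards with x
      exact Measurable.aestronglyMeasurable (by fun_prop)
    · filter_upwards [hev] with x hx
      filter_upwards [hne] with t ht1 ht
      rw [Set.uIoc_of_le zero_le_one] at ht
      have ht2 : t < 1 := lt_of_le_of_ne ht.2 ht1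
      have h1 : x * t ^ 2 ≤ t := by
        have h2 : x * t ≤ 1 := mul_le_one₀ hx.2.le ht.1.le ht.2
        nlinarith [ht.1]
      have h3 : 0 ≤ x * t ^ 2 := mul_nonneg hx.1.le (sq_nonneg t)
      rw [Real.norm_of_nonneg (Real.rpow_nonneg (by linarith) _)]
      exact rpow_le_one_add_rpow (by linarith) (by linarith) (by linarith)
    · filter_upwards [hne] with t ht1 ht
      rw [Set.uIoc_of_le zero_le_one] at ht
      have ht2 : t < 1 := lt_of_le_of_ne ht.2 ht1
      have h1 : ContinuousAt (fun x : ℝ => (1 - x * t ^ 2) ^ (-b)) 1 := by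
        refine ContinuousAt.rpow_const (by fun_prop) (Or.inl ?_)
        nlinarith [ht.1]
      have h2 := tendsto_nhdsWithin_of_tendsto_nhds (s := Set.Iio 1) h1.tendsto
      rwa [one_mul] at h2
  refine hmain.congr' ?_
  filter_upwards [hev] with x hx
  exact (ordinaryHypergeometric_half_eq_integral b hx.1.le hx.2).symm

theorem exists_tendsto_schwarzBound {α : ℝ} (hα : -1 < α) :
    ∃ L : ℝ, Tendsto (fun r : ℝ => schwarzBound r α) (𝓝[<] 1) (𝓝 L) := by
  have hev : ∀ᶠ x : ℝ in 𝓝[<] 1, x ∈ Set.Ioo (0 : ℝ) 1 := Ioo_mem_nhdsLT (by norm_num)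
  have hid : Tendsto (fun r : ℝ => r) (𝓝[<] 1) (𝓝 1) :=
    tendsto_nhdsWithin_of_tendsto_nhds tendsto_id
  have hx : Tendsto (fun r : ℝ => 4 * r ^ 2 / (1 + r ^ 2) ^ 2) (𝓝[<] 1) (𝓝[<] 1) := by
    refine tendsto_nhdsWithin_iff.2 ⟨?_, ?_⟩
    · have h : ContinuousAt (fun r : ℝ => 4 * r ^ 2 / (1 + r ^ 2) ^ 2) 1 :=
        ContinuousAt.div (by fun_prop) (by fun_prop) (by norm_num)
      have := tendsto_nhdsWithin_of_tendsto_nhds (s := Set.Iio 1) h.tendsto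
      norm_num at this
      exact this
    · filter_upwards [hev] with r hr
      have hs : 0 < 1 - r ^ 2 := by nlinarith [hr.1, hr.2]
      rw [Set.mem_Iio, div_lt_one (by positivity)]
      nlinarith
  have hF := (tendsto_ordinaryHypergeometric_half (b := 1 / 2 - α / 2) (by linarith)).comp hx
  -- `(1 - r²)^(α+1) |(1 - r)^(-α) - 1| = |(1 - r) (1 + r)^(α+1) - (1 - r²)^(α+1)|`, whose
  -- right hand side is continuous at `r = 1`.
  have hfirst : Tendsto (fun r : ℝ => (1 - r ^ 2) ^ (α + 1) * |(1 - r) ^ (-α) - 1| / (1 + r ^ 2))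
      (𝓝[<] 1) (𝓝 (|(1 - 1) * (1 + 1) ^ (α + 1) - (1 - 1 ^ 2) ^ (α + 1)| / (1 + 1 ^ 2))) := by
    have hc : ContinuousAt (fun r : ℝ =>
        |(1 - r) * (1 + r) ^ (α + 1) - (1 - r ^ 2) ^ (α + 1)| / (1 + r ^ 2)) 1 := by
      have h1 : ContinuousAt (fun r : ℝ => (1 + r) ^ (α + 1)) 1 :=
        ContinuousAt.rpow_const (by fun_prop) (Or.inr (by linarith))
      have h2 : ContinuousAt (fun r : ℝ => (1 - r ^ 2) ^ (α + 1)) 1 :=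
        ContinuousAt.rpow_const (by fun_prop) (Or.inr (by linarith))
      exact ContinuousAt.div (by fun_prop) (by fun_prop) (by norm_num)
    refine (tendsto_nhdsWithin_of_tendsto_nhds hc.tendsto).congr' ?_
    filter_upwards [hev] with r hr
    have h1 : 0 < 1 - r := by linarith [hr.2]
    have h2 : 0 < 1 + r := by linarith [hr.1]
    have h3 : 1 - r ^ 2 = (1 - r) * (1 + r) := by ring
    have h4 : 0 ≤ (1 - r ^ 2) ^ (α + 1) := Real.rpow_nonneg (by rw [h3]; positivity) _
    congr 1
    rw [← abs_of_nonneg h4, ← abs_mul, abs_of_nonneg h4]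
    congr 1
    rw [mul_sub, mul_one, h3, Real.mul_rpow h1.le h2.le]
    have h5 : (1 - r) ^ (α + 1) * (1 - r) ^ (-α) = 1 - r := by
      rw [← Real.rpow_add h1]; simp
    linear_combination (-(1 + r) ^ (α + 1)) * h5
  have hsecond : Tendsto (fun r : ℝ => (if 0 ≤ α then (2 : ℝ) ^ (2 + α / 2) else 4) * r / Real.pi *
      (1 + r ^ 2) ^ (α / 2 - 1)) (𝓝[<] 1) (𝓝 ((if 0 ≤ α then (2 : ℝ) ^ (2 + α / 2) else 4) * 1 /
        Real.pi * (1 + 1 ^ 2) ^ (α / 2 - 1))) := by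
    refine ((hid.const_mul _).div_const _).mul ?_
    exact ((hid.pow 2).const_add 1).rpow_const (Or.inl (by norm_num))
  exact ⟨_, hfirst.add (hsecond.mul hF)⟩

/-- The estimate at a point of the disk, for a function bounded by `1`. -/
theorem norm_sub_le_schwarzBound {α : ℝ} (hα : -1 < α) {f : ℂ → ℂ} (hf : IsAlphaHarmonic α f)
    (hbd : ∀ z ∈ Metric.ball (0 : ℂ) 1, ‖f z‖ ≤ 1) {z : ℂ} (hz : z ∈ Metric.ball (0 : ℂ) 1) :
    ‖f z - (((1 - ‖z‖ ^ 2) ^ (α + 1) / (1 + ‖z‖ ^ 2) : ℝ) : ℂ) * f 0‖ ≤ schwarzBound ‖z‖ α := by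
  rcases eq_or_ne z 0 with rfl | hz0
  · simp [schwarzBound]
  · have hr : ‖z‖ ∈ Set.Ioo (0 : ℝ) 1 := ⟨norm_pos_iff.2 hz0, by simpa using hz⟩
    have hpolar : (‖z‖ : ℂ) * Circle.exp z.arg = z := by
      rw [Circle.coe_exp]; exact Complex.norm_mul_exp_arg_mul_I z
    have h := (norm_sub_mul_le_integral hα hf hbd _ hr z.arg).trans
      (integral_norm_poissonKernel_sub_le hα hr)
    rw [hpolar] at h
    exact le_of_mul_le_mul_left h Real.two_pi_pos

end AlphaHarmonic

theorem mainTheorem2 (α : ℝ) (hα : -1 < α) :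
    (∀ (f : ℂ → ℂ) (fstar : Circle → ℂ), Continuous fstar →
      AlphaHarmonic.SolvesDirichlet α f fstar →
      Set.MapsTo f (Metric.ball 0 1) (Metric.ball 0 1) →
      ∀ z ∈ Metric.ball (0 : ℂ) 1,
        ‖f z - (((1 - ‖z‖ ^ 2) ^ (α + 1) / (1 + ‖z‖ ^ 2) : ℝ) : ℂ) * f 0‖ ≤
          AlphaHarmonic.schwarzBound ‖z‖ α) ∧
    ∃ L : ℝ, Tendsto (fun r : ℝ => AlphaHarmonic.schwarzBound r α) (𝓝[<] 1) (𝓝 L) := by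
  refine ⟨fun f _ _ hf hmaps z hz => ?_, AlphaHarmonic.exists_tendsto_schwarzBound hα⟩
  refine AlphaHarmonic.norm_sub_le_schwarzBound hα hf.1 (fun w hw => ?_) hz
  simpa using (mem_ball_zero_iff.1 (hmaps hw)).le
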